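/- Let $(\Omega,\mathcal F,\mathbb P)$ be a complete probability space, $E$ a separable real Banach space with Borel $\sigma$-algebra $\mathcal B(E)$ and dual $E^*$, and $p\in\{0\}\cup[1,\infty)$. Let $L^0(E)$ be the space of classes (modulo almost sure equality) of $E$-valued random variables with the topology of convergence in probability, and for $p\ge 1$ let $L^p(E)$ be the space of those with $\mathbb E\|\xi\|^p<\infty$, with its norm topology. Write $\operatorname{cl}_p$ for the closure in $L^p(E)$, $\operatorname{conv}$ for the convex hull, and $\overline{\operatorname{conv}}$ for the closed convex hull (in $E$, or in $L^p(E)$). *Decomposable hull.* $S\subseteq L^p(E)$ is decomposable if $1_B\xi+1_{B^c}\zeta\in S$ for all $\xi,\zeta\in S$, $B\in\mathcal F$; $\operatorname{dec}A$ is the smallest decomposable subset of $L^p(E)$ containing $A$. *Closed random sets.* A closed random set is a map $X:\Omega\to 2^E$ with graph in $\mathcal F\otimes\mathcal B(E)$ and with $X(\omega)$ closed for almost every $\omega$; $L^p(X)$ is the set of all $\xi\in L^p(E)$ with $\xi\in X$ almost surely. For nonempty $A\subseteq L^p(E)$, $F_A$ denotes a closed random set with $\operatorname{cl}_p\operatorname{dec}A=L^p(F_A)$.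 *Barycenters and the Choquet hull.* A point $y$ of a Banach space $V$ is the barycenter of a Borel probability measure $m$ on $V$ if every $L\in V^*$ is $m$-integrable and $L(y)=\int_V L\,dm$. A set $C\subseteq V$ is a Choquet set if it contains the barycenter of every regular Borel probability measure that has a barycenter and satisfies $m(B)=1$ for some Borel $B\subseteq C$. The Choquet hull $\operatorname{ch}A$ is the smallest Choquet set containing $A$. *Choquet decomposable hulls.* A transition probability kernel $K$ from $(\Omega,\mathcal F)$ to $(E,\mathcal B(E))$ has barycenter $Y\in L^p(E)$ if, for almost every $\omega$, $Y(\omega)$ is the barycenter of $K(\omega,\cdot)$. For nonempty $A\subseteq L^p(E)$ let $\mathcal K_p(A)$ be the set of regular transition probability kernels $K$ having a barycenter in $L^p(E)$ with $K(\omega,F_A(\omega))=1$ for almost every $\omega$, and let $\mathcal K_p^\delta(A)$ be the set of those $K\in\mathcal K_p(A)$ for which $K(\omega,\cdot)$ is a Dirac measure for almost every $\omega$. A nonempty set $A$ is $p$-Choquet convex decomposable (resp. $p$-Choquet decomposable) if it contains the barycenter of every $K\in\mathcal K_p(A)$ (resp. $K\in\mathcal K_p^\delta(A)$); $\operatorname{chcd}_pA$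 (resp. $\operatorname{chd}_pA$) is the intersection of all such subsets of $L^p(E)$ containing $A$. **Statement.** Let $\emptyset\ne A\subseteq L^p(E)$. Then the closed random set $F_A$ exists and is unique up to almost sure equality, and $$\operatorname{chcd}_pA=\operatorname{chd}_p\operatorname{conv}A=L^p(\overline{\operatorname{conv}}\,F_A)=\overline{\operatorname{conv}}\,L^p(F_A)=\overline{\operatorname{conv}}\,\operatorname{chd}_pA=\operatorname{cl}_p\operatorname{conv}\operatorname{dec}A=\operatorname{cl}_p\operatorname{dec}\operatorname{conv}A .$$ If moreover $p\ge1$, so that $L^p(E)$ is a Banach space, these sets also equal $\operatorname{chd}_p\operatorname{ch}A$. -/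

import Mathlib

open MeasureTheory ProbabilityTheory Filter Topology
open scoped ENNReal

noncomputable section

namespace ChoquetHulls

/-! ### Choquet combinations in a Banach space -/

section Banach

variable {V : Type*} [NormedAddCommGroup V] [NormedSpace ℝ V] [MeasurableSpace V]

/-- `y` is the barycenter of the Borel measure `m`: every continuous linear functional `L` is
`m`-integrable with integral `L y`. -/
def IsBarycenter (m : Measure V) (y : V) : Prop :=
  ∀ L : StrongDual ℝ V, Integrable (fun x => L x) m ∧ L y = ∫ x, L x ∂m

/-- `y` is a Choquet combination of points of `A`: it is the barycenter of a regular Borel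
probability measure carried by some Borel subset of `A`. -/
def IsChoquetCombination [BorelSpace V] (A : Set V) (y : V) : Prop :=
  ∃ m : Measure V, IsProbabilityMeasure m ∧ m.Regular ∧
    (∃ B : Set V, B ⊆ A ∧ MeasurableSet B ∧ m B = 1) ∧ IsBarycenter m y

/-- A Choquet set contains all Choquet combinations of its points. -/
def IsChoquetSet [BorelSpace V] (A : Set V) : Prop :=
  ∀ y : V, IsChoquetCombination A y → y ∈ A

/-- The Choquet hull: the intersection of all Choquet sets containing `A`. -/
def choquetHull [BorelSpace V] (A : Set V) : Set V :=
  ⋂₀ {B : Set V | A ⊆ B ∧ IsChoquetSet B}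

end Banach

/-! ### Subsets of the spaces `L^p(E)`, `p = 0` or `1 ≤ p < ∞`

All the spaces `L^p(E)` are regarded as subspaces of the space `Ω →ₘ[μ] E` of classes, modulo
almost sure equality, of `E`-valued random variables. For `p = 0`, `Lp E 0 μ` is the whole of
`Ω →ₘ[μ] E`, because `eLpNorm f 0 μ = 0` for all `f`; its Mathlib norm is not used. -/

section Lebesgue

variable {Ω E : Type*} [MeasurableSpace Ω] [NormedAddCommGroup E] [NormedSpace ℝ E]

/-- Convergence in probability if `p = 0`, convergence in the `L^p` norm otherwise. -/
def ConvergesLp (p : ℝ≥0∞) (μ : Measure Ω) (u : ℕ → Ω →ₘ[μ] E) (f : Ω →ₘ[μ] E) : Prop :=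
  if p = 0 then TendstoInMeasure μ (fun n => (u n : Ω → E)) atTop (f : Ω → E)
  else Tendsto (fun n => eLpNorm (⇑(u n) - ⇑f) p μ) atTop (𝓝 0)

/-- The closure in `L^p(E)` (whose topology is metrizable, so sequences suffice). -/
def clLp (p : ℝ≥0∞) (μ : Measure Ω) (S : Set (Ω →ₘ[μ] E)) : Set (Ω →ₘ[μ] E) :=
  {f | f ∈ Lp E p μ ∧ ∃ u : ℕ → Ω →ₘ[μ] E, (∀ n, u n ∈ S) ∧ ConvergesLp p μ u f}

/-- The closed convex hull in `L^p(E)`. -/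
def cconvLp (p : ℝ≥0∞) (μ : Measure Ω) (S : Set (Ω →ₘ[μ] E)) : Set (Ω →ₘ[μ] E) :=
  clLp p μ (convexHull ℝ S)

/-- `S` is decomposable: it contains `1_B ξ + 1_{Bᶜ} ζ` for all `ξ, ζ ∈ S` and all events `B`. -/
def IsDecomposable (μ : Measure Ω) (S : Set (Ω →ₘ[μ] E)) : Prop :=
  ∀ ξ ∈ S, ∀ ζ ∈ S, ∀ B : Set Ω, MeasurableSet B → ∀ η : Ω →ₘ[μ] E,
    (∀ᵐ ω ∂μ, η ω = B.indicator (⇑ξ) ω + Bᶜ.indicator (⇑ζ) ω) → η ∈ S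

/-- The decomposable hull of `A` in `L^p(E)`. -/
def decHull (p : ℝ≥0∞) (μ : Measure Ω) (A : Set (Ω →ₘ[μ] E)) : Set (Ω →ₘ[μ] E) :=
  ⋂₀ {B | A ⊆ B ∧ B ⊆ (Lp E p μ : Set (Ω →ₘ[μ] E)) ∧ IsDecomposable μ B}

/-- `L^p(X)`: the `p`-integrable selections of the multifunction `X`. -/
def selections (p : ℝ≥0∞) (μ : Measure Ω) (X : Ω → Set E) : Set (Ω →ₘ[μ] E) :=
  {ξ | ξ ∈ Lp E p μ ∧ ∀ᵐ ω ∂μ, ξ ω ∈ X ω}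

/-- `X` is a closed random set: its graph is jointly measurable and almost all of its values are
closed. -/
def IsClosedRandomSet [MeasurableSpace E] (μ : Measure Ω) (X : Ω → Set E) : Prop :=
  MeasurableSet {z : Ω × E | z.2 ∈ X z.1} ∧ ∀ᵐ ω ∂μ, IsClosed (X ω)

/-- `F` is a version of the closed random set `F_A` determined by `cl_p dec A = L^p(F_A)`. -/
def Represents [MeasurableSpace E] (p : ℝ≥0∞) (μ : Measure Ω) (F : Ω → Set E)
    (A : Set (Ω →ₘ[μ] E)) : Prop :=
  IsClosedRandomSet μ F ∧ clLp p μ (decHull p μ A) = selections p μ F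

/-- `Y` is the barycenter of the transition kernel `K`: for almost every `ω`, the point `Y(ω)` is
the barycenter of the measure `K(ω)`. -/
def IsKernelBarycenter [MeasurableSpace E] (μ : Measure Ω) (K : Kernel Ω E) (Y : Ω →ₘ[μ] E) :
    Prop :=
  ∀ᵐ ω ∂μ, IsBarycenter (K ω) (Y ω)

/-- `K` is a regular transition probability kernel with `K(ω, F_A(ω)) = 1` almost surely. -/
def IsKernelOn [MeasurableSpace E] (p : ℝ≥0∞) (μ : Measure Ω) (A : Set (Ω →ₘ[μ] E))
    (K : Kernel Ω E) : Prop :=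
  IsMarkovKernel K ∧ (∀ ω, (K ω).Regular) ∧
    ∃ F : Ω → Set E, Represents p μ F A ∧ ∀ᵐ ω ∂μ, K ω (F ω) = 1

/-- `A` is a `p`-Choquet convex decomposable subset of `L^p(E)`: it contains the barycenter of
every kernel on `A` that has a barycenter in `L^p(E)`. -/
def IsChoquetConvexDecomposable [MeasurableSpace E] (p : ℝ≥0∞) (μ : Measure Ω)
    (A : Set (Ω →ₘ[μ] E)) : Prop :=
  A ⊆ (Lp E p μ : Set (Ω →ₘ[μ] E)) ∧
    ∀ K : Kernel Ω E, IsKernelOn p μ A K →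
      ∀ Y ∈ Lp E p μ, IsKernelBarycenter μ K Y → Y ∈ A

/-- `A` is a `p`-Choquet decomposable subset of `L^p(E)`: as before, but only for those kernels
almost all of whose values are Dirac measures. -/
def IsChoquetDecomposable [MeasurableSpace E] (p : ℝ≥0∞) (μ : Measure Ω)
    (A : Set (Ω →ₘ[μ] E)) : Prop :=
  A ⊆ (Lp E p μ : Set (Ω →ₘ[μ] E)) ∧
    ∀ K : Kernel Ω E, IsKernelOn p μ A K → (∀ᵐ ω ∂μ, ∃ x : E, K ω = Measure.dirac x) →
      ∀ Y ∈ Lp E p μ, IsKernelBarycenter μ K Y → Y ∈ A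

/-- The `p`-Choquet convex decomposable hull. -/
def chcd [MeasurableSpace E] (p : ℝ≥0∞) (μ : Measure Ω) (A : Set (Ω →ₘ[μ] E)) :
    Set (Ω →ₘ[μ] E) :=
  ⋂₀ {B | A ⊆ B ∧ IsChoquetConvexDecomposable p μ B}

/-- The `p`-Choquet decomposable hull. -/
def chd [MeasurableSpace E] (p : ℝ≥0∞) (μ : Measure Ω) (A : Set (Ω →ₘ[μ] E)) :
    Set (Ω →ₘ[μ] E) :=
  ⋂₀ {B | A ⊆ B ∧ IsChoquetDecomposable p μ B}

/-- For `1 ≤ p`, the Choquet hull of a subset of `L^p(E)`, taken in the Banach space `L^p(E)` with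
its Borel `σ`-algebra. -/
def choquetHullLp (p : ℝ≥0∞) [Fact (1 ≤ p)] (μ : Measure Ω) (A : Set (Ω →ₘ[μ] E)) :
    Set (Ω →ₘ[μ] E) :=
  letI : MeasurableSpace (Lp E p μ) := borel (Lp E p μ)
  haveI : BorelSpace (Lp E p μ) := ⟨rfl⟩
  (fun f : Lp E p μ => (f : Ω →ₘ[μ] E)) ''
    choquetHull {f : Lp E p μ | (f : Ω →ₘ[μ] E) ∈ A}

end Lebesgue

end ChoquetHulls

end

open ChoquetHulls

/-! All the hulls reduce to one object: the smallest convex closed decomposable set containing `A`.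

A kernel of Dirac measures with barycenter `Y` is almost surely `δ_Y`, and it is carried by `F_S`
exactly when `Y` is a selection of `F_S`. Hence a nonempty `S` is Choquet decomposable iff it
contains `cl_p dec S`, that is, iff it is closed and decomposable; this gives `chd_p A = cl_p dec A`
(`chd_eq`). With general kernels, two-point mixtures also force convexity. Conversely, if `S` is
convex, closed and decomposable, then `F_S` has closed convex values almost surely, and Hahn–Banach
puts the barycenter of a probability measure carried by `F_S(ω)` back into `F_S(ω)`. So `chcd_p A`
is the minimal set above (`chcd_eq_of_minimal`).

Each other expression is then checked to be convex, closed, decomposable and minimal. The hull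
operations cooperate: the convex hull of a decomposable set is decomposable, the decomposable hull
of a convex set is convex, and closure preserves both properties. The Choquet hull is convex and
lies between `A` and `cl_p conv A`, so it may replace `conv A`.

Behind this stands the representation of closed decomposable sets as `L^p(F)`. Existence
(`exists_eq_selections`) comes from a sequence in `S` that nearly minimises the mean truncated
distance to each point of a dense sequence of `E`; its pointwise closure is `F`. Uniqueness
(`ae_subset_of_selections_subset`) needs a measurable section of `F \ G` over an event of positive
measure, obtained from analytic sets. -/

namespace ChoquetHulls

/-! ### Measurable sections of product-measurable sets -/

section Selection

/-- Every set of the product `σ`-algebra is the preimage of a Borel set under a map which only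
transforms the first coordinate, with values in a Polish space. -/
theorem exists_measurable_factor {Ω E : Type*} [MeasurableSpace Ω] [MeasurableSpace E]
    {D : Set (Ω × E)} (hD : MeasurableSet D) :
    ∃ (φ : Ω → ℕ → ℝ) (D' : Set ((ℕ → ℝ) × E)), Measurable φ ∧ MeasurableSet D' ∧
      D = (fun z : Ω × E => (φ z.1, z.2)) ⁻¹' D' := by
  induction D, hD using MeasurableSpace.induction_on_inter generateFrom_prod.symm isPiSystem_prod with
  | empty => exact ⟨0, ∅, measurable_const, .empty, rfl⟩
  | basic t ht =>
    obtain ⟨s, hs, u, hu, rfl⟩ := ht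
    refine ⟨fun ω _ => s.indicator 1 ω, {z | z.1 0 = 1 ∧ z.2 ∈ u}, ?_, ?_, ?_⟩
    · exact measurable_pi_lambda _ fun _ => measurable_one.indicator hs
    · exact (measurableSet_eq_fun ((measurable_pi_apply 0).comp measurable_fst)
        measurable_const).inter (measurable_snd hu)
    · ext ⟨ω, x⟩
      by_cases h : ω ∈ s <;> simp [h]
  | compl t _ ih =>
    obtain ⟨φ, D', hφ, hD', rfl⟩ := ih
    exact ⟨φ, D'ᶜ, hφ, hD'.compl, rfl⟩
  | iUnion f _ _ ih =>
    choose φ D' hφ hD' hf using ih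
    -- Countably many factor maps are interleaved into one by the pairing function.
    refine ⟨fun ω n => φ n.unpair.1 ω n.unpair.2,
      ⋃ i, (fun z : (ℕ → ℝ) × E => ((fun k => z.1 (Nat.pair i k)), z.2)) ⁻¹' D' i, ?_, ?_, ?_⟩
    · exact measurable_pi_lambda _ fun n => (measurable_pi_apply _).comp (hφ _)
    · refine .iUnion fun i => ?_
      refine Measurable.prodMk (measurable_pi_lambda _ fun k => ?_) measurable_snd (hD' i)
      exact (measurable_pi_apply _).comp measurable_fst
    · ext ⟨ω, x⟩
      simp [hf]

/-- An analytic set of positive outer measure contains a compact image of positive measure. -/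
theorem exists_isCompact_image_pos {X : Type*} [TopologicalSpace X] [MeasurableSpace X]
    (ν : Measure X) [ν.OuterRegular] {f : (ℕ → ℕ) → X} (hf : Continuous f)
    (hpos : 0 < ν (Set.range f)) : ∃ K : Set (ℕ → ℕ), IsCompact K ∧ 0 < ν (f '' K) := by
  obtain ⟨c, hc0, hc⟩ := exists_between hpos
  let C : (ℕ → ℕ) → ℕ → Set (ℕ → ℕ) := fun b k => {x | ∀ i < k, x i ≤ b i}
  have step : ∀ k b, c < ν (f '' C b k) →
      ∃ m, c < ν (f '' C (Function.update b k m) (k + 1)) := by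
    intro k b h
    have hmono : Monotone fun m => f '' C (Function.update b k m) (k + 1) := by
      intro m m' hm
      refine Set.image_mono fun x hx i hi => (hx i hi).trans ?_
      rcases eq_or_ne i k with rfl | hik
      · simpa using hm
      · simp [hik]
    have hU : f '' C b k ⊆ ⋃ m, f '' C (Function.update b k m) (k + 1) := by
      rintro _ ⟨x, hx, rfl⟩
      refine Set.mem_iUnion.2 ⟨x k, x, fun i hi => ?_, rfl⟩
      rcases eq_or_ne i k with rfl | hik
      · simp
      · simpa [hik] using hx i (by omega)
    have h2 := h.trans_le (measure_mono hU)
    rw [hmono.measure_iUnion] at h2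
    exact lt_iSup_iff.1 h2
  choose! m hm using step
  let F : (k : ℕ) → {b : ℕ → ℕ // c < ν (f '' C b k)} := fun k =>
    Nat.rec ⟨0, by simpa [C] using hc⟩
      (fun k b => ⟨Function.update b.1 k (m k b.1), hm k b.1 b.2⟩) k
  have hF : ∀ k, (F (k + 1)).1 = Function.update (F k).1 k (m k (F k).1) := fun k => rfl
  -- The bound on coordinate `i` is chosen when passing to stage `i + 1` and never changes
  -- afterwards.
  let b : ℕ → ℕ := fun i => (F (i + 1)).1 i
  have hFb : ∀ k, ∀ i < k, (F k).1 i = b i := by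
    intro k
    induction k with
    | zero => intro i hi; omega
    | succ k ih =>
      intro i hi
      rcases eq_or_ne i k with rfl | hik
      · rfl
      · rw [hF, Function.update_of_ne hik, ih i (by omega)]
  have hb : ∀ k, c < ν (f '' C b k) := by
    intro k
    have : C b k = C (F k).1 k := by
      ext x
      exact forall₂_congr fun i hi => by rw [hFb k i hi]
    rw [this]
    exact (F k).2
  let K : Set (ℕ → ℕ) := Set.univ.pi fun i => Set.Iic (b i)
  have hK : IsCompact K := isCompact_univ_pi fun i => (Set.finite_Iic (b i)).isCompact
  refine ⟨K, hK, hc0.trans_le ?_⟩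
  rw [Set.measure_eq_iInf_isOpen]
  refine le_iInf₂ fun U hU => le_iInf fun hUo => ?_
  by_contra! hlt
  have hex : ∀ k, ∃ x ∈ C b k, f x ∉ U := by
    intro k
    by_contra! h
    exact absurd ((hb k).trans_le (measure_mono (Set.image_subset_iff.2 h))) hlt.not_gt
  choose x hxC hxU using hex
  -- Only the first `k` coordinates of `x k` are bounded by `b`. Zeroing the others lands in the
  -- compact `K` without affecting coordinatewise limits.
  let y : ℕ → ℕ → ℕ := fun k i => if i < k then x k i else 0
  have hyK : ∀ k, y k ∈ K := by
    intro k i _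
    by_cases h : i < k
    · simpa [y, h] using hxC k i h
    · simp [y, h]
  obtain ⟨z, hzK, θ, hθ, hlim⟩ := hK.tendsto_subseq hyK
  have hlim' : Tendsto (x ∘ θ) atTop (𝓝 z) := by
    rw [tendsto_pi_nhds] at hlim ⊢
    intro i
    refine (hlim i).congr' ?_
    filter_upwards [eventually_gt_atTop i] with k hk
    have : i < θ k := hk.trans_le hθ.le_apply
    simp [y, this]
  have hzU : f z ∈ U := hU ⟨z, hzK, rfl⟩
  obtain ⟨k, hk⟩ := (((hf.tendsto z).comp hlim').eventually (hUo.mem_nhds hzU)).exists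
  exact hxU _ hk

/-- The Baire space admits a continuous injection into the real line. -/
theorem exists_continuous_injective_baire :
    ∃ ψ : (ℕ → ℕ) → ℝ, Continuous ψ ∧ Function.Injective ψ := by
  classical
  -- `x` is encoded by the indicator of its graph, and the binary sequence is then sent into a
  -- Cantor set; any ratio below `1 / 2` makes this injective.
  let e : (ℕ → ℕ) → ℕ → Bool := fun x n => decide (x n.unpair.1 = n.unpair.2)
  refine ⟨fun x => Cardinal.cantorFunction (1 / 3) (e x), ?_, ?_⟩
  · refine continuous_tsum (u := fun n => (1 / 3 : ℝ) ^ n) (fun n => ?_)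
      (summable_geometric_of_lt_one (by norm_num) (by norm_num)) fun n x => ?_
    · have h : Continuous fun x : ℕ → ℕ => e x n :=
        (continuous_of_discreteTopology (f := fun k : ℕ => decide (k = n.unpair.2))).comp
          (continuous_apply n.unpair.1)
      exact (continuous_of_discreteTopology
        (f := fun b : Bool => cond b ((1 / 3 : ℝ) ^ n) 0)).comp h
    · unfold Cardinal.cantorFunctionAux
      cases e x n <;> simp
  · intro x y hxy
    have h := Cardinal.cantorFunction_injective (c := 1 / 3) (by norm_num) (by norm_num) hxy
    funext i
    have h2 := congrFun h (Nat.pair i (x i))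
    simp only [e, Nat.unpair_pair, decide_true] at h2
    exact (of_decide_eq_true h2.symm).symm

/-- A continuous map on a compact subset of the Baire space has a Borel right inverse. -/
theorem exists_measurable_rightInverse_of_isCompact {X : Type*} [TopologicalSpace X] [T2Space X]
    [SecondCountableTopology X]
    [MeasurableSpace X] [BorelSpace X] {K : Set (ℕ → ℕ)} (hK : IsCompact K)
    {g : (ℕ → ℕ) → X} (hg : Continuous g) :
    ∃ s : X → ℕ → ℕ, Measurable s ∧ ∀ y ∈ g '' K, g (s y) = y := by
  obtain ⟨ψ, hψ, hψi⟩ := exists_continuous_injective_baire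
  -- `L` keeps from each fibre of `g` in `K` its unique minimiser of `ψ`. Rational thresholds make
  -- it Borel, and `g` is injective on it.
  let L : Set (ℕ → ℕ) := K \ ⋃ q : ℚ, ψ ⁻¹' Set.Ioi (q : ℝ) ∩ g ⁻¹' (g '' (K ∩ ψ ⁻¹' Set.Iic (q : ℝ)))
  have hL : MeasurableSet L := by
    refine hK.measurableSet.diff (.iUnion fun q => ?_)
    refine (hψ.measurable measurableSet_Ioi).inter (hg.measurable ?_)
    exact ((hK.inter_right (isClosed_Iic.preimage hψ)).image hg).measurableSet
  have hLmin : ∀ x ∈ L, ∀ x' ∈ K, g x' = g x → ψ x ≤ ψ x' := by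
    intro x hx x' hx' hgx
    by_contra! hlt
    obtain ⟨q, hq1, hq2⟩ := exists_rat_btwn hlt
    exact hx.2 (Set.mem_iUnion.2 ⟨q, hq2, x', ⟨hx', hq1.le⟩, hgx⟩)
  have hinj : Set.InjOn g L := fun x hx x' hx' h =>
    hψi (le_antisymm (hLmin x hx x' hx'.1 h.symm) (hLmin x' hx' x hx.1 h))
  have hemb := hg.continuousOn.measurableEmbedding hL hinj
  obtain ⟨s, hs, hsL⟩ := hemb.exists_measurable_extend (g := fun x : L => (x : ℕ → ℕ))
    measurable_subtype_coe fun _ => inferInstance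
  refine ⟨s, hs, ?_⟩
  rintro _ ⟨x, hx, rfl⟩
  obtain ⟨z, ⟨hzK, hzx⟩, hz⟩ := (hK.inter_right (isClosed_singleton.preimage hg :
    IsClosed (g ⁻¹' {g x}))).exists_isMinOn ⟨x, hx, rfl⟩ hψ.continuousOn
  have hzL : z ∈ L := by
    refine ⟨hzK, fun h => ?_⟩
    obtain ⟨q, hq, x', ⟨hx', hq'⟩, hgx⟩ := Set.mem_iUnion.1 h
    have h1 : ψ z ≤ ψ x' := hz ⟨hx', by simpa [hgx] using hzx⟩
    exact absurd (h1.trans hq') (not_le.2 hq)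
  have h3 : s (g z) = z := congrFun hsL ⟨z, hzL⟩
  have h4 : g z = g x := hzx
  rw [← h4, h3]

/-- If the projection of a measurable subset of `Ω × E` is not null, then the set contains the
graph of a measurable map over an event of positive measure. -/
theorem exists_measurable_section {Ω E : Type*} [MeasurableSpace Ω] (μ : Measure Ω)
    [IsFiniteMeasure μ] [TopologicalSpace E] [PolishSpace E] [MeasurableSpace E] [BorelSpace E]
    {D : Set (Ω × E)} (hD : MeasurableSet D) (hpos : ¬ ∀ᵐ ω ∂μ, ∀ x, (ω, x) ∉ D) :
    ∃ B, MeasurableSet B ∧ 0 < μ B ∧ ∃ η : Ω → E, Measurable η ∧ ∀ ω ∈ B, (ω, η ω) ∈ D := by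
  obtain ⟨φ, D', hφ, hD', rfl⟩ := exists_measurable_factor hD
  have hpre : {ω | ¬ ∀ x, (ω, x) ∉ (fun z : Ω × E => (φ z.1, z.2)) ⁻¹' D'} =
      φ ⁻¹' (Prod.fst '' D') := by
    ext ω
    simp
  rw [ae_iff, hpre] at hpos
  -- The projection is only analytic, so its measures are outer measures; the inequality needed here
  -- holds for arbitrary sets.
  have hν : 0 < μ.map φ (Prod.fst '' D') :=
    (pos_iff_ne_zero.2 hpos).trans_le (Measure.le_map_apply hφ.aemeasurable _)
  have han := hD'.analyticSet
  rw [AnalyticSet] at han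
  rcases han with rfl | ⟨f, hf, rfl⟩
  · simp at hν
  rw [← Set.range_comp] at hν
  have hg : Continuous (Prod.fst ∘ f) := continuous_fst.comp hf
  obtain ⟨K, hK, hKpos⟩ := exists_isCompact_image_pos (μ.map φ) hg hν
  obtain ⟨s, hs, hsK⟩ := exists_measurable_rightInverse_of_isCompact hK hg
  have hKm : MeasurableSet (Prod.fst ∘ f '' K) := (hK.image hg).measurableSet
  refine ⟨φ ⁻¹' (Prod.fst ∘ f '' K), hφ hKm, ?_, fun ω => (f (s (φ ω))).2, ?_, ?_⟩
  · rwa [Measure.map_apply hφ hKm] at hKpos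
  · exact measurable_snd.comp (hf.measurable.comp (hs.comp hφ))
  · intro ω hω
    refine ⟨s (φ ω), Prod.ext (hsK _ hω) rfl⟩

end Selection

/-! ### Gluing along events, and a distance for `L^p(E)` -/

section Distance

variable {Ω E : Type*} [MeasurableSpace Ω] [NormedAddCommGroup E] {p : ℝ≥0∞} {μ : Measure Ω}

theorem mem_Lp_of_norm_le_add {f g h : Ω →ₘ[μ] E} (hf : f ∈ Lp E p μ) (hg : g ∈ Lp E p μ)
    (h_le : ∀ᵐ ω ∂μ, ‖h ω‖ ≤ ‖f ω‖ + ‖g ω‖) : h ∈ Lp E p μ := by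
  rw [Lp.mem_Lp_iff_memLp] at *
  refine (hf.norm.add hg.norm).of_le h.aestronglyMeasurable ?_
  filter_upwards [h_le] with ω hω
  exact hω.trans (Real.le_norm_self _)

/-- The element equal to `f` on `B` and to `g` off `B`. -/
noncomputable def glue {B : Set Ω} (hB : MeasurableSet B) (f g : Ω →ₘ[μ] E) : Ω →ₘ[μ] E :=
  AEEqFun.mk (fun ω => B.indicator f ω + Bᶜ.indicator g ω)
    ((f.aestronglyMeasurable.indicator hB).add (g.aestronglyMeasurable.indicator hB.compl))

theorem coeFn_glue {B : Set Ω} (hB : MeasurableSet B) (f g : Ω →ₘ[μ] E) :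
    ∀ᵐ ω ∂μ, glue hB f g ω = B.indicator f ω + Bᶜ.indicator g ω :=
  AEEqFun.coeFn_mk _ _

theorem ae_glue {B : Set Ω} (hB : MeasurableSet B) (f g : Ω →ₘ[μ] E) :
    ∀ᵐ ω ∂μ, (ω ∈ B → glue hB f g ω = f ω) ∧ (ω ∉ B → glue hB f g ω = g ω) := by
  filter_upwards [coeFn_glue hB f g] with ω hω
  by_cases h : ω ∈ B <;> simp [hω, h]

theorem eq_glue_iff {B : Set Ω} (hB : MeasurableSet B) {f g η : Ω →ₘ[μ] E} :
    (∀ᵐ ω ∂μ, η ω = B.indicator f ω + Bᶜ.indicator g ω) ↔ η = glue hB f g := by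
  refine ⟨fun h => AEEqFun.ext ?_, fun h => h ▸ coeFn_glue hB f g⟩
  filter_upwards [h, coeFn_glue hB f g] with ω h1 h2
  rw [h1, h2]

theorem glue_self {B : Set Ω} (hB : MeasurableSet B) (f : Ω →ₘ[μ] E) : glue hB f f = f := by
  refine AEEqFun.ext ?_
  filter_upwards [ae_glue hB f f] with ω hω
  by_cases h : ω ∈ B
  exacts [hω.1 h, hω.2 h]

theorem glue_mem_Lp {B : Set Ω} (hB : MeasurableSet B) {f g : Ω →ₘ[μ] E} (hf : f ∈ Lp E p μ)
    (hg : g ∈ Lp E p μ) : glue hB f g ∈ Lp E p μ := by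
  refine mem_Lp_of_norm_le_add hf hg ?_
  filter_upwards [ae_glue hB f g] with ω hω
  by_cases h : ω ∈ B
  · rw [hω.1 h]; linarith [norm_nonneg (g ω)]
  · rw [hω.2 h]; linarith [norm_nonneg (f ω)]

/-- A distance inducing the convergence in `L^p(E)`. -/
noncomputable def distLp (p : ℝ≥0∞) (μ : Measure Ω) (f g : Ω →ₘ[μ] E) : ℝ≥0∞ :=
  if p = 0 then ∫⁻ ω, min 1 ‖f ω - g ω‖ₑ ∂μ else eLpNorm (⇑f - ⇑g) p μ

theorem aestronglyMeasurable_coeFn_sub (f g : Ω →ₘ[μ] E) :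
    AEStronglyMeasurable (⇑f - ⇑g) μ :=
  f.aestronglyMeasurable.sub g.aestronglyMeasurable

theorem aemeasurable_truncation (f g : Ω →ₘ[μ] E) :
    AEMeasurable (fun ω => min 1 ‖f ω - g ω‖ₑ) μ :=
  aemeasurable_const.min (aestronglyMeasurable_coeFn_sub f g).enorm

theorem distLp_self (f : Ω →ₘ[μ] E) : distLp p μ f f = 0 := by
  unfold distLp
  split_ifs <;> simp

/-- Subadditivity of `min 1` for `p = 0`, Minkowski for `p ≥ 1`. With six functions, it serves the
triangle inequality, convex combinations and gluing alike. -/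
theorem distLp_le_add (hp : p = 0 ∨ 1 ≤ p) {f g f₁ g₁ f₂ g₂ : Ω →ₘ[μ] E}
    (h : ∀ᵐ ω ∂μ, ‖f ω - g ω‖ ≤ ‖f₁ ω - g₁ ω‖ + ‖f₂ ω - g₂ ω‖) :
    distLp p μ f g ≤ distLp p μ f₁ g₁ + distLp p μ f₂ g₂ := by
  have h' : ∀ᵐ ω ∂μ, ‖f ω - g ω‖ₑ ≤ ‖f₁ ω - g₁ ω‖ₑ + ‖f₂ ω - g₂ ω‖ₑ := by
    filter_upwards [h] with ω hω
    simp only [← ofReal_norm]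
    rw [← ENNReal.ofReal_add (norm_nonneg _) (norm_nonneg _)]
    exact ENNReal.ofReal_le_ofReal hω
  unfold distLp
  split_ifs with h0
  · rw [← lintegral_add_left' (aemeasurable_truncation f₁ g₁)]
    refine lintegral_mono_ae ?_
    filter_upwards [h'] with ω hω
    rcases le_total 1 ‖f₁ ω - g₁ ω‖ₑ with h1 | h1
    · rw [min_eq_left h1]
      exact (min_le_left _ _).trans le_self_add
    · rcases le_total 1 ‖f₂ ω - g₂ ω‖ₑ with h2 | h2
      · rw [min_eq_left h2]
        exact (min_le_left _ _).trans le_add_self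
      · rw [min_eq_right h1, min_eq_right h2]
        exact (min_le_right _ _).trans hω
  · have h1 := hp.resolve_left h0
    refine (eLpNorm_mono_ae_real (g := fun ω => ‖f₁ ω - g₁ ω‖ + ‖f₂ ω - g₂ ω‖) h).trans ?_
    refine (eLpNorm_add_le (aestronglyMeasurable_coeFn_sub f₁ g₁).norm
      (aestronglyMeasurable_coeFn_sub f₂ g₂).norm h1).trans_eq ?_
    rw [eLpNorm_norm, eLpNorm_norm]

theorem distLp_triangle (hp : p = 0 ∨ 1 ≤ p) (f g h : Ω →ₘ[μ] E) :
    distLp p μ f h ≤ distLp p μ f g + distLp p μ g h :=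
  distLp_le_add hp (by exact .of_forall fun _ => norm_sub_le_norm_sub_add_norm_sub _ _ _)

end Distance

/-! ### Closure in `L^p(E)`; convexity and decomposability -/

section Closure

variable {Ω E : Type*} [MeasurableSpace Ω] [NormedAddCommGroup E] {p : ℝ≥0∞}
  {μ : Measure Ω} {S T : Set (Ω →ₘ[μ] E)}

/-- For `p = 0`, one direction bounds `min 1 t` by `δ` plus the indicator of `t ≥ δ`, with `δ` small
against the total mass; the other is Markov's inequality. -/
theorem convergesLp_iff [IsFiniteMeasure μ] {u : ℕ → Ω →ₘ[μ] E} {f : Ω →ₘ[μ] E} :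
    ConvergesLp p μ u f ↔ Tendsto (fun n => distLp p μ (u n) f) atTop (𝓝 0) := by
  unfold ConvergesLp distLp
  split_ifs with h0
  swap
  · rfl
  rw [tendstoInMeasure_iff_enorm]
  constructor
  · intro h
    rw [ENNReal.tendsto_nhds_zero]
    intro ε hε
    obtain ⟨δ, hδ, hδε⟩ : ∃ δ : ℝ≥0∞, 0 < δ ∧ δ ≠ ∞ ∧ δ * μ Set.univ ≤ ε / 2 := by
      by_cases hμ : μ Set.univ = 0
      · exact ⟨1, one_pos, ENNReal.one_ne_top, by simp [hμ]⟩
      · refine ⟨min 1 (ε / 2 / μ Set.univ), lt_min one_pos ?_, ?_, ?_⟩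
        · exact ENNReal.div_pos (ENNReal.half_pos hε.ne').ne' (measure_ne_top _ _)
        · exact ((min_le_left _ _).trans_lt ENNReal.one_lt_top).ne
        · exact (mul_le_mul_left (min_le_right _ _) _).trans ((mul_comm _ _).trans_le ENNReal.mul_div_le)
    have h2 := (ENNReal.tendsto_nhds_zero.1 (h δ hδ hδε.1)) (ε / 2) (ENNReal.half_pos hε.ne')
    filter_upwards [h2] with n hn
    have hm : NullMeasurableSet {ω | δ ≤ ‖u n ω - f ω‖ₑ} μ :=
      nullMeasurableSet_le aemeasurable_const (aestronglyMeasurable_coeFn_sub (u n) f).enorm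
    calc ∫⁻ ω, min 1 ‖u n ω - f ω‖ₑ ∂μ
        ≤ ∫⁻ ω, δ + {ω | δ ≤ ‖u n ω - f ω‖ₑ}.indicator 1 ω ∂μ := by
          refine lintegral_mono fun ω => ?_
          by_cases hω : δ ≤ ‖u n ω - f ω‖ₑ
          · simp [hω]
          · exact (min_le_right _ _).trans ((not_le.1 hω).le.trans le_self_add)
      _ = δ * μ Set.univ + μ {ω | δ ≤ ‖u n ω - f ω‖ₑ} := by
          rw [lintegral_add_left measurable_const, lintegral_const, lintegral_indicator_one₀ hm]
      _ ≤ ε / 2 + ε / 2 := add_le_add hδε.2 hn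
      _ = ε := ENNReal.add_halves ε
  · intro h δ hδ hδ'
    have hδ0 : min 1 δ ≠ 0 := (lt_min one_pos hδ).ne'
    have hδ1 : min 1 δ ≠ ∞ := ((min_le_left _ _).trans_lt ENNReal.one_lt_top).ne
    have h2 : Tendsto (fun n => (∫⁻ ω, min 1 ‖u n ω - f ω‖ₑ ∂μ) / min 1 δ) atTop (𝓝 0) := by
      simpa using ENNReal.Tendsto.div_const h (.inr hδ0)
    refine tendsto_of_tendsto_of_tendsto_of_le_of_le tendsto_const_nhds h2
      (fun _ => zero_le) fun n => ?_
    refine (measure_mono fun ω hω => ?_).trans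
      (meas_ge_le_lintegral_div (aemeasurable_truncation (u n) f) hδ0 hδ1)
    exact min_le_min_left 1 (Set.mem_ofPred_eq ▸ hω)

theorem tendstoInMeasure_of_convergesLp {u : ℕ → Ω →ₘ[μ] E} {f : Ω →ₘ[μ] E}
    (h : ConvergesLp p μ u f) : TendstoInMeasure μ (fun n => (u n : Ω → E)) atTop (f : Ω → E) := by
  unfold ConvergesLp at h
  split_ifs at h with h0
  · exact h
  · exact tendstoInMeasure_of_tendsto_eLpNorm h0 (fun n => (u n).aestronglyMeasurable)
      f.aestronglyMeasurable h

theorem convergesLp_of_dominated [IsFiniteMeasure μ] (hp : p ≠ ∞) {u : ℕ → Ω →ₘ[μ] E}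
    {f h : Ω →ₘ[μ] E} (hh : h ∈ Lp E p μ) (hle : ∀ n, ∀ᵐ ω ∂μ, ‖u n ω - f ω‖ ≤ ‖h ω‖)
    (hlim : ∀ᵐ ω ∂μ, Tendsto (fun n => u n ω) atTop (𝓝 (f ω))) : ConvergesLp p μ u f := by
  unfold ConvergesLp
  split_ifs with h0
  · exact tendstoInMeasure_of_tendsto_ae (fun n => (u n).aestronglyMeasurable) hlim
  · have hp0 : 0 < p.toReal := ENNReal.toReal_pos h0 hp
    have key : Tendsto (fun n => ∫⁻ ω, ‖u n ω - f ω‖ₑ ^ p.toReal ∂μ) atTop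
        (𝓝 (∫⁻ _, 0 ∂μ)) := by
      refine tendsto_lintegral_of_dominated_convergence' (fun ω => ‖h ω‖ₑ ^ p.toReal)
        (fun n => (aestronglyMeasurable_coeFn_sub (u n) f).enorm.pow_const _) ?_ ?_ ?_
      · intro n
        filter_upwards [hle n] with ω hω
        exact ENNReal.rpow_le_rpow (enorm_le_iff_norm_le.2 hω) hp0.le
      · exact (lintegral_rpow_enorm_lt_top_of_eLpNorm_lt_top h0 hp (Lp.mem_Lp_iff_eLpNorm_lt_top.1 hh)).ne
      · filter_upwards [hlim] with ω hω
        have h1 : Tendsto (fun n => ‖u n ω - f ω‖ₑ) atTop (𝓝 0) := by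
          have := (hω.sub_const (f ω)).enorm
          simpa using this
        have h2 := h1.ennrpow_const p.toReal
        rwa [ENNReal.zero_rpow_of_pos hp0] at h2
    rw [lintegral_zero] at key
    have h3 := key.ennrpow_const (1 / p.toReal)
    rw [ENNReal.zero_rpow_of_pos (by positivity)] at h3
    simpa only [eLpNorm_eq_lintegral_rpow_enorm_toReal h0 hp, Pi.sub_apply] using h3

theorem clLp_subset_Lp : clLp p μ S ⊆ (Lp E p μ : Set (Ω →ₘ[μ] E)) := fun _ h => h.1

theorem clLp_mono (h : S ⊆ T) : clLp p μ S ⊆ clLp p μ T :=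
  fun _ ⟨hf, u, hu, hlim⟩ => ⟨hf, u, fun n => h (hu n), hlim⟩

theorem mem_clLp_iff [IsFiniteMeasure μ] {f : Ω →ₘ[μ] E} :
    f ∈ clLp p μ S ↔ f ∈ Lp E p μ ∧ ∀ ε : ℝ≥0∞, 0 < ε → ∃ u ∈ S, distLp p μ u f < ε := by
  refine and_congr_right fun _ => ⟨?_, fun h => ?_⟩
  · rintro ⟨u, hu, hlim⟩ ε hε
    obtain ⟨n, hn⟩ := ((convergesLp_iff.1 hlim).eventually (gt_mem_nhds hε)).exists
    exact ⟨u n, hu n, hn⟩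
  · have h' : ∀ n : ℕ, ∃ u ∈ S, distLp p μ u f < ((n : ℝ≥0∞) + 1)⁻¹ := fun n => h _ (by simp)
    choose u hu hlt using h'
    refine ⟨u, hu, convergesLp_iff.2 ?_⟩
    have hlim : Tendsto (fun n : ℕ => ((n : ℝ≥0∞) + 1)⁻¹) atTop (𝓝 0) := by
      have := (tendsto_add_atTop_iff_nat 1).2 ENNReal.tendsto_inv_nat_nhds_zero
      simpa using this
    exact tendsto_of_tendsto_of_tendsto_of_le_of_le tendsto_const_nhds hlim
      (fun _ => zero_le) fun n => (hlt n).le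

theorem subset_clLp [IsFiniteMeasure μ] (hS : S ⊆ (Lp E p μ : Set (Ω →ₘ[μ] E))) :
    S ⊆ clLp p μ S := fun f hf =>
  mem_clLp_iff.2 ⟨hS hf, fun ε hε => ⟨f, hf, by rwa [distLp_self]⟩⟩

theorem clLp_clLp_subset [IsFiniteMeasure μ] (hp : p = 0 ∨ 1 ≤ p) :
    clLp p μ (clLp p μ S) ⊆ clLp p μ S := by
  intro f hf
  rw [mem_clLp_iff] at hf ⊢
  refine ⟨hf.1, fun ε hε => ?_⟩
  obtain ⟨g, hg, hgf⟩ := hf.2 (ε / 2) (ENNReal.half_pos hε.ne')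
  obtain ⟨u, hu, hug⟩ := (mem_clLp_iff.1 hg).2 (ε / 2) (ENNReal.half_pos hε.ne')
  refine ⟨u, hu, (distLp_triangle hp u g f).trans_lt ?_⟩
  exact (ENNReal.add_lt_add hug hgf).trans_eq (ENNReal.add_halves ε)

theorem norm_convexComb_sub_le [NormedSpace ℝ E] {a b : ℝ} (ha : 0 ≤ a) (hb : 0 ≤ b) (hab : a + b = 1)
    (x y x' y' : E) : ‖(a • x + b • y) - (a • x' + b • y')‖ ≤ ‖x - x'‖ + ‖y - y'‖ := by
  have h : (a • x + b • y) - (a • x' + b • y') = a • (x - x') + b • (y - y') := by module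
  rw [h]
  refine (norm_add_le _ _).trans (add_le_add ?_ ?_)
  · rw [norm_smul, Real.norm_of_nonneg ha]
    exact mul_le_of_le_one_left (norm_nonneg _) (by linarith)
  · rw [norm_smul, Real.norm_of_nonneg hb]
    exact mul_le_of_le_one_left (norm_nonneg _) (by linarith)

theorem coeFn_comb [NormedSpace ℝ E] (a b : ℝ) (f g : Ω →ₘ[μ] E) :
    ∀ᵐ ω ∂μ, (a • f + b • g : Ω →ₘ[μ] E) ω = a • f ω + b • g ω := by
  filter_upwards [AEEqFun.coeFn_add (a • f) (b • g), AEEqFun.coeFn_smul a f,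
    AEEqFun.coeFn_smul b g] with ω h1 h2 h3
  simp [h1, h2, h3]

theorem convex_Lp [NormedSpace ℝ E] : Convex ℝ (Lp E p μ : Set (Ω →ₘ[μ] E)) := by
  intro f hf g hg a b ha hb hab
  refine mem_Lp_of_norm_le_add hf hg ?_
  filter_upwards [coeFn_comb a b f g] with ω hω
  simpa [hω] using norm_convexComb_sub_le ha hb hab (f ω) (g ω) 0 0

theorem convex_clLp [NormedSpace ℝ E] [IsFiniteMeasure μ] (hp : p = 0 ∨ 1 ≤ p) (hS : Convex ℝ S) :
    Convex ℝ (clLp p μ S) := by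
  intro f hf g hg a b ha hb hab
  refine mem_clLp_iff.2 ⟨convex_Lp hf.1 hg.1 ha hb hab, fun ε hε => ?_⟩
  obtain ⟨u, hu, huf⟩ := (mem_clLp_iff.1 hf).2 (ε / 2) (ENNReal.half_pos hε.ne')
  obtain ⟨v, hv, hvg⟩ := (mem_clLp_iff.1 hg).2 (ε / 2) (ENNReal.half_pos hε.ne')
  refine ⟨a • u + b • v, hS hu hv ha hb hab,
    (distLp_le_add hp (f₁ := u) (g₁ := f) (f₂ := v) (g₂ := g) ?_).trans_lt
    ((ENNReal.add_lt_add huf hvg).trans_eq (ENNReal.add_halves ε))⟩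
  filter_upwards [coeFn_comb a b f g, coeFn_comb a b u v] with ω h1 h2
  rw [h1, h2]
  exact norm_convexComb_sub_le ha hb hab _ _ _ _

theorem isDecomposable_iff :
    IsDecomposable μ S ↔ ∀ f ∈ S, ∀ g ∈ S, ∀ (B : Set Ω) (hB : MeasurableSet B),
      glue hB f g ∈ S := by
  refine ⟨fun h f hf g hg B hB => h f hf g hg B hB _ (coeFn_glue hB f g), ?_⟩
  intro h f hf g hg B hB η hη
  rw [(eq_glue_iff hB).1 hη]
  exact h f hf g hg B hB

theorem isDecomposable_Lp : IsDecomposable μ (Lp E p μ : Set (Ω →ₘ[μ] E)) :=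
  isDecomposable_iff.2 fun _ hf _ hg _ hB => glue_mem_Lp hB hf hg

theorem isDecomposable_clLp [IsFiniteMeasure μ] (hp : p = 0 ∨ 1 ≤ p) (hS : IsDecomposable μ S) :
    IsDecomposable μ (clLp p μ S) := by
  rw [isDecomposable_iff] at *
  intro f hf g hg B hB
  refine mem_clLp_iff.2 ⟨glue_mem_Lp hB hf.1 hg.1, fun ε hε => ?_⟩
  obtain ⟨u, hu, huf⟩ := (mem_clLp_iff.1 hf).2 (ε / 2) (ENNReal.half_pos hε.ne')
  obtain ⟨v, hv, hvg⟩ := (mem_clLp_iff.1 hg).2 (ε / 2) (ENNReal.half_pos hε.ne')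
  refine ⟨glue hB u v, hS u hu v hv B hB,
    (distLp_le_add hp (f₁ := u) (g₁ := f) (f₂ := v) (g₂ := g) ?_).trans_lt
    ((ENNReal.add_lt_add huf hvg).trans_eq (ENNReal.add_halves ε))⟩
  filter_upwards [ae_glue hB f g, ae_glue hB u v] with ω h1 h2
  by_cases h : ω ∈ B
  · rw [h1.1 h, h2.1 h]
    linarith [norm_nonneg (v ω - g ω)]
  · rw [h1.2 h, h2.2 h]
    linarith [norm_nonneg (u ω - f ω)]

theorem subset_decHull (A : Set (Ω →ₘ[μ] E)) : A ⊆ decHull p μ A :=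
  fun _ hf _ hB => hB.1 hf

theorem decHull_subset_of_isDecomposable (hST : S ⊆ T) (hT : T ⊆ (Lp E p μ : Set (Ω →ₘ[μ] E)))
    (hd : IsDecomposable μ T) : decHull p μ S ⊆ T := fun _ hf => hf T ⟨hST, hT, hd⟩

theorem decHull_subset_Lp (hS : S ⊆ (Lp E p μ : Set (Ω →ₘ[μ] E))) :
    decHull p μ S ⊆ (Lp E p μ : Set (Ω →ₘ[μ] E)) :=
  decHull_subset_of_isDecomposable hS subset_rfl isDecomposable_Lp

theorem isDecomposable_decHull : IsDecomposable μ (decHull p μ S) :=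
  fun f hf g hg B hB η hη T hT =>
    hT.2.2 f (hf T hT) g (hg T hT) B hB η hη

/-- This interchange law is why convex and decomposable hulls are compatible. -/
theorem glue_comb [NormedSpace ℝ E] (a b : ℝ) {B : Set Ω} (hB : MeasurableSet B) (f f' g g' : Ω →ₘ[μ] E) :
    glue hB (a • f + b • g) (a • f' + b • g') = a • glue hB f f' + b • glue hB g g' := by
  refine AEEqFun.ext ?_
  filter_upwards [ae_glue hB (a • f + b • g) (a • f' + b • g'), ae_glue hB f f', ae_glue hB g g',
    coeFn_comb a b f g, coeFn_comb a b f' g', coeFn_comb a b (glue hB f f') (glue hB g g')]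
    with ω h1 h2 h3 h4 h5 h6
  by_cases h : ω ∈ B
  · rw [h1.1 h, h6, h2.1 h, h3.1 h, h4]
  · rw [h1.2 h, h6, h2.2 h, h3.2 h, h5]

/-- The convex hull of a decomposable set is decomposable. -/
theorem isDecomposable_convexHull [NormedSpace ℝ E] (hS : IsDecomposable μ S) :
    IsDecomposable μ (convexHull ℝ S) := by
  rw [isDecomposable_iff] at *
  -- One argument at a time: with the other fixed, the good arguments form a convex set containing
  -- `S`.
  have key : ∀ f ∈ S, ∀ g ∈ convexHull ℝ S, ∀ (B : Set Ω) (hB : MeasurableSet B),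
      glue hB f g ∈ convexHull ℝ S := by
    intro f hf g hg B hB
    refine convexHull_min (t := {g | glue hB f g ∈ convexHull ℝ S})
      (fun g hg => subset_convexHull ℝ S (hS f hf g hg B hB)) ?_ hg
    intro g hg g' hg' a b ha hb hab
    have h := (convex_convexHull ℝ S) hg hg' ha hb hab
    rwa [← glue_comb, Convex.combo_self hab] at h
  intro f hf g hg B hB
  refine convexHull_min (t := {f | glue hB f g ∈ convexHull ℝ S})
      (fun f hf => key f hf g hg B hB) ?_ hf
  intro f hf f' hf' a b ha hb hab
  have h := (convex_convexHull ℝ S) hf hf' ha hb hab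
  rwa [← glue_comb, Convex.combo_self hab] at h

/-- The decomposable hull of a convex set is convex. -/
theorem convex_decHull [NormedSpace ℝ E] (hSp : S ⊆ (Lp E p μ : Set (Ω →ₘ[μ] E))) (hS : Convex ℝ S) :
    Convex ℝ (decHull p μ S) := by
  have hdec := isDecomposable_iff.1 (isDecomposable_decHull (p := p) (S := S))
  have key : ∀ f ∈ S, ∀ g ∈ decHull p μ S, ∀ a b : ℝ, 0 ≤ a → 0 ≤ b → a + b = 1 →
      a • f + b • g ∈ decHull p μ S := by
    intro f hf g hg a b ha hb hab
    refine (decHull_subset_of_isDecomposable (S := S) (p := p)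
      (T := {g | g ∈ Lp E p μ ∧ a • f + b • g ∈ decHull p μ S})
      (fun g hg => ⟨hSp hg, subset_decHull S (hS hf hg ha hb hab)⟩) (fun g hg => hg.1)
      (isDecomposable_iff.2 ?_) hg).2
    intro g hg g' hg' B hB
    refine ⟨glue_mem_Lp hB hg.1 hg'.1, ?_⟩
    have h := hdec _ hg.2 _ hg'.2 B hB
    rwa [glue_comb, glue_self] at h
  intro f hf g hg a b ha hb hab
  refine (decHull_subset_of_isDecomposable (S := S) (p := p)
      (T := {f | f ∈ Lp E p μ ∧ a • f + b • g ∈ decHull p μ S})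
      (fun f hf => ⟨hSp hf, key f hf g hg a b ha hb hab⟩) (fun f hf => hf.1)
      (isDecomposable_iff.2 ?_) hf).2
  intro f hf f' hf' B hB
  refine ⟨glue_mem_Lp hB hf.1 hf'.1, ?_⟩
  have h := hdec _ hf.2 _ hf'.2 B hB
  rwa [glue_comb, glue_self] at h

end Closure

/-! ### Generating sequences and existence of the random set -/

section Castaing

variable {Ω E : Type*} [MeasurableSpace Ω] [NormedAddCommGroup E] {p : ℝ≥0∞} {μ : Measure Ω}
  {S : Set (Ω →ₘ[μ] E)}

/-- The random set generated by a sequence of random variables. -/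
def generatedSet (ξ : ℕ → Ω →ₘ[μ] E) (ω : Ω) : Set E := closure (Set.range fun n => ξ n ω)

theorem measurableSet_norm_sub_lt (f g h : Ω →ₘ[μ] E) :
    MeasurableSet {ω | ‖f ω - h ω‖ < ‖g ω - h ω‖} :=
  measurableSet_lt (f.stronglyMeasurable.sub h.stronglyMeasurable).norm.measurable
    (g.stronglyMeasurable.sub h.stronglyMeasurable).norm.measurable

/-- Pointwise, `closestApprox ξ f n` is the member of `ξ 0, …, ξ n` closest to `f`. -/
noncomputable def closestApprox (ξ : ℕ → Ω →ₘ[μ] E) (f : Ω →ₘ[μ] E) : ℕ → Ω →ₘ[μ] E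
  | 0 => ξ 0
  | n + 1 => glue (measurableSet_norm_sub_lt (ξ (n + 1)) (closestApprox ξ f n) f) (ξ (n + 1))
      (closestApprox ξ f n)

theorem closestApprox_mem (hS : IsDecomposable μ S) {ξ : ℕ → Ω →ₘ[μ] E} (hξ : ∀ n, ξ n ∈ S)
    (f : Ω →ₘ[μ] E) (n : ℕ) : closestApprox ξ f n ∈ S := by
  induction n with
  | zero => exact hξ 0
  | succ n ih => exact isDecomposable_iff.1 hS _ (hξ _) _ ih _ _

theorem ae_norm_closestApprox_sub (ξ : ℕ → Ω →ₘ[μ] E) (f : Ω →ₘ[μ] E) :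
    ∀ᵐ ω ∂μ, ∀ n m, m ≤ n → ‖closestApprox ξ f n ω - f ω‖ ≤ ‖ξ m ω - f ω‖ := by
  have h : ∀ᵐ ω ∂μ, ∀ n, ‖closestApprox ξ f (n + 1) ω - f ω‖ ≤ ‖closestApprox ξ f n ω - f ω‖ ∧
      ‖closestApprox ξ f (n + 1) ω - f ω‖ ≤ ‖ξ (n + 1) ω - f ω‖ := by
    refine ae_all_iff.2 fun n => ?_
    filter_upwards [ae_glue (measurableSet_norm_sub_lt (ξ (n + 1)) (closestApprox ξ f n) f)
      (ξ (n + 1)) (closestApprox ξ f n)] with ω hω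
    change ‖glue _ _ _ ω - f ω‖ ≤ _ ∧ ‖glue _ _ _ ω - f ω‖ ≤ _
    by_cases hlt : ‖ξ (n + 1) ω - f ω‖ < ‖closestApprox ξ f n ω - f ω‖
    · rw [hω.1 hlt]
      exact ⟨hlt.le, le_rfl⟩
    · rw [hω.2 hlt]
      exact ⟨le_rfl, not_lt.1 hlt⟩
  filter_upwards [h] with ω hω n
  induction n with
  | zero =>
    intro m hm
    rw [Nat.le_zero.1 hm]
    exact le_rfl
  | succ n ih =>
    intro m hm
    rcases Nat.le_succ_iff.1 hm with hm | rfl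
    · exact (hω n).1.trans (ih m hm)
    · exact (hω n).2

/-- A closed decomposable set contains all integrable selections of the random set generated by
its members. -/
theorem mem_of_ae_mem_generatedSet [IsFiniteMeasure μ] (hp : p ≠ ∞)
    (hSp : S ⊆ (Lp E p μ : Set (Ω →ₘ[μ] E))) (hcl : clLp p μ S ⊆ S) (hdec : IsDecomposable μ S)
    {ξ : ℕ → Ω →ₘ[μ] E} (hξ : ∀ n, ξ n ∈ S) {f : Ω →ₘ[μ] E} (hf : f ∈ Lp E p μ)
    (hfξ : ∀ᵐ ω ∂μ, f ω ∈ generatedSet ξ ω) : f ∈ S := by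
  -- No approximant is farther from `f` than `ξ 0`, so `ξ 0 - f` dominates.
  refine hcl ⟨hf, closestApprox ξ f, closestApprox_mem hdec hξ f,
    convergesLp_of_dominated hp (h := ξ 0 - f) (sub_mem (hSp (hξ 0)) hf) (fun n => ?_) ?_⟩
  · filter_upwards [ae_norm_closestApprox_sub ξ f, AEEqFun.coeFn_sub (ξ 0) f] with ω h1 h2
    rw [h2]
    exact h1 n 0 n.zero_le
  · filter_upwards [ae_norm_closestApprox_sub ξ f, hfξ] with ω h1 h2
    rw [Metric.tendsto_atTop]
    intro ε hε
    obtain ⟨_, ⟨m, rfl⟩, hm⟩ := Metric.mem_closure_iff.1 h2 ε hε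
    refine ⟨m, fun n hn => ?_⟩
    rw [dist_eq_norm]
    rw [dist_comm, dist_eq_norm] at hm
    exact (h1 n m hn).trans_lt hm

/-- A decomposable set has a sequence of members that generates a random set of which all members
are selections. -/
theorem exists_ae_mem_generatedSet [IsFiniteMeasure μ] [TopologicalSpace.SeparableSpace E]
    (hne : S.Nonempty) (hdec : IsDecomposable μ S) :
    ∃ ξ : ℕ → Ω →ₘ[μ] E, (∀ n, ξ n ∈ S) ∧ ∀ f ∈ S, ∀ᵐ ω ∂μ, f ω ∈ generatedSet ξ ω := by
  let x : ℕ → E := TopologicalSpace.denseSeq E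
  -- Truncation keeps the integrals finite whatever `p` is.
  let a : ℕ → (Ω →ₘ[μ] E) → Ω → ℝ≥0∞ := fun i f ω => min 1 ‖f ω - x i‖ₑ
  have ham : ∀ i f, Measurable (a i f) := fun i f =>
    measurable_const.min (f.stronglyMeasurable.sub stronglyMeasurable_const).enorm
  have hafin : ∀ i f, ∫⁻ ω, a i f ω ∂μ ≠ ∞ := fun i f =>
    ((lintegral_mono fun ω => min_le_left 1 ‖f ω - x i‖ₑ).trans_lt (by simp)).ne
  let α : ℕ → ℝ≥0∞ := fun i => ⨅ f ∈ S, ∫⁻ ω, a i f ω ∂μ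
  have hα : ∀ i f, f ∈ S → α i ≤ ∫⁻ ω, a i f ω ∂μ := fun i f hf => iInf₂_le f hf
  have hαfin : ∀ i, α i ≠ ∞ := fun i =>
    ((hα i _ hne.some_mem).trans_lt (hafin i _).lt_top).ne
  have hex : ∀ i j : ℕ, ∃ f ∈ S, ∫⁻ ω, a i f ω ∂μ < α i + ((j : ℝ≥0∞) + 1)⁻¹ := by
    intro i j
    have h : α i < α i + ((j : ℝ≥0∞) + 1)⁻¹ := ENNReal.lt_add_right (hαfin i) (by simp)
    obtain ⟨f, hf⟩ := iInf_lt_iff.1 h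
    obtain ⟨hfS, hf⟩ := iInf_lt_iff.1 hf
    exact ⟨f, hfS, hf⟩
  choose ζ hζS hζ using hex
  refine ⟨fun n => ζ n.unpair.1 n.unpair.2, fun n => hζS _ _, fun f hf => ?_⟩
  have key : ∀ᵐ ω ∂μ, ∀ i, ⨅ j, (a i (ζ i j) ω - a i f ω) = 0 := by
    refine ae_all_iff.2 fun i => ?_
    have hle : ∀ j : ℕ, ∫⁻ ω, (a i (ζ i j) ω - a i f ω) ∂μ ≤ ((j : ℝ≥0∞) + 1)⁻¹ := by
      intro j
      -- Replacing `ζ i j` by `f` where `f` is closer to `x i` stays in `S`, so the integral cannot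
      -- drop below the infimum `α i`. The gain, which is the integral of the truncated difference,
      -- is thus at most `1 / (j + 1)`.
      let B : Set Ω := {ω | a i f ω < a i (ζ i j) ω}
      have hB : MeasurableSet B := measurableSet_lt (ham i f) (ham i (ζ i j))
      have hg : glue hB f (ζ i j) ∈ S := isDecomposable_iff.1 hdec _ hf _ (hζS i j) B hB
      have hmin : ∀ᵐ ω ∂μ, a i (glue hB f (ζ i j)) ω = min (a i f ω) (a i (ζ i j) ω) := by
        filter_upwards [ae_glue hB f (ζ i j)] with ω hω
        by_cases h : ω ∈ B
        · simp only [a, hω.1 h]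
          exact (min_eq_left (le_of_lt h)).symm
        · simp only [a, hω.2 h]
          exact (min_eq_right (not_lt.1 h)).symm
      have hsub : ∫⁻ ω, (a i (ζ i j) ω - a i f ω) ∂μ =
          ∫⁻ ω, a i (ζ i j) ω ∂μ - ∫⁻ ω, a i (glue hB f (ζ i j)) ω ∂μ := by
        rw [← lintegral_sub (ham i _) (hafin i _)
          (by filter_upwards [hmin] with ω hω; rw [hω]; exact min_le_right _ _)]
        refine lintegral_congr_ae ?_
        filter_upwards [hmin] with ω hω
        rw [hω]
        rcases le_total (a i f ω) (a i (ζ i j) ω) with h | h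
        · rw [min_eq_left h]
        · rw [min_eq_right h, tsub_self, tsub_eq_zero_of_le h]
      rw [hsub, tsub_le_iff_left]
      exact (hζ i j).le.trans (add_le_add_left (hα i _ hg) _)
    have hzero : ∫⁻ ω, ⨅ j, (a i (ζ i j) ω - a i f ω) ∂μ = 0 := by
      refine le_antisymm (ge_of_tendsto' (x := atTop)
        (f := fun j : ℕ => ((j : ℝ≥0∞) + 1)⁻¹) ?_ fun j => ?_) zero_le
      · simpa using (tendsto_add_atTop_iff_nat 1).2 ENNReal.tendsto_inv_nat_nhds_zero
      · exact (lintegral_mono fun ω => iInf_le _ j).trans (hle j)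
    have hm : Measurable fun ω => ⨅ j, (a i (ζ i j) ω - a i f ω) :=
      .iInf fun j => (ham i _).sub (ham i f)
    exact (lintegral_eq_zero_iff hm).1 hzero
  filter_upwards [key] with ω hω
  rw [generatedSet, EMetric.mem_closure_iff]
  intro ε hε
  -- Three distances of size `δ` must add up to at most `ε`; the cap by `1` gives `δ + δ ≤ 1`, which
  -- lets the truncation in `a` be removed.
  let δ : ℝ≥0∞ := min ε 1 / 3
  have hδ : 0 < δ := ENNReal.div_pos (lt_min hε one_pos).ne' (by simp)
  have hδtop : min ε 1 ≠ ∞ := ((min_le_right ε 1).trans_lt ENNReal.one_lt_top).ne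
  have hδ3 : δ + δ + δ = min ε 1 := ENNReal.add_thirds _
  have hδfin : δ ≠ ∞ := fun h => hδtop (by rw [← hδ3, h]; simp)
  obtain ⟨_, ⟨i, rfl⟩, hi⟩ := EMetric.mem_closure_iff.1
    (TopologicalSpace.denseRange_denseSeq E (f ω)) δ hδ
  have hlt : ⨅ j, (a i (ζ i j) ω - a i f ω) < δ := by rwa [hω i]
  obtain ⟨j, hj⟩ := iInf_lt_iff.1 hlt
  have haf : a i f ω ≤ δ := (min_le_right _ _).trans (by rw [← edist_eq_enorm_sub]; exact hi.le)
  have hlt2 : a i (ζ i j) ω < δ + δ :=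
    le_tsub_add.trans_lt (ENNReal.add_lt_add_of_lt_of_le (haf.trans_lt hδfin.lt_top).ne hj haf)
  have hsum : δ + δ ≤ min ε 1 := le_self_add.trans_eq hδ3
  have hlt3 : ‖ζ i j ω - x i‖ₑ < δ + δ := (min_lt_iff.1 hlt2).resolve_left
    (not_lt.2 (hsum.trans (min_le_right _ _)))
  rw [← edist_eq_enorm_sub, edist_comm] at hlt3
  refine ⟨ζ i j ω, ⟨Nat.pair i j, by simp⟩, ?_⟩
  calc edist (f ω) (ζ i j ω) ≤ edist (f ω) (x i) + edist (x i) (ζ i j ω) := edist_triangle _ _ _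
    _ < δ + (δ + δ) := ENNReal.add_lt_add hi hlt3
    _ = min ε 1 := by rw [← hδ3, add_assoc]
    _ ≤ ε := min_le_left _ _

/-- A nonempty closed decomposable subset of `L^p(E)` consists of the integrable selections of a
random set generated by a sequence of its members. -/
theorem exists_eq_selections [IsFiniteMeasure μ] [TopologicalSpace.SeparableSpace E] (hp : p ≠ ∞)
    (hne : S.Nonempty) (hSp : S ⊆ (Lp E p μ : Set (Ω →ₘ[μ] E))) (hcl : clLp p μ S ⊆ S)
    (hdec : IsDecomposable μ S) :
    ∃ ξ : ℕ → Ω →ₘ[μ] E, (∀ n, ξ n ∈ S) ∧ S = selections p μ (generatedSet ξ) := by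
  obtain ⟨ξ, hξ, h⟩ := exists_ae_mem_generatedSet hne hdec
  exact ⟨ξ, hξ, subset_antisymm (fun f hf => ⟨hSp hf, h f hf⟩)
    fun f hf => mem_of_ae_mem_generatedSet hp hSp hcl hdec hξ hf.1 hf.2⟩

/-- Lying in the closure of a sequence is a countable condition on distances, tested at the radii `1
/ (k + 1)`. -/
theorem isClosedRandomSet_generatedSet [TopologicalSpace.SeparableSpace E] [MeasurableSpace E]
    [BorelSpace E] (ξ : ℕ → Ω →ₘ[μ] E) : IsClosedRandomSet μ (generatedSet ξ) := by
  refine ⟨?_, .of_forall fun ω => isClosed_closure⟩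
  have h : {z : Ω × E | z.2 ∈ generatedSet ξ z.1} =
      ⋂ k : ℕ, ⋃ n, {z : Ω × E | dist z.2 (ξ n z.1) < 1 / ((k : ℝ) + 1)} := by
    ext z
    simp only [generatedSet, Metric.mem_closure_range_iff, Set.mem_iInter, Set.mem_iUnion]
    refine ⟨fun h k => h _ (by positivity), fun h ε hε => ?_⟩
    obtain ⟨k, hk⟩ := exists_nat_one_div_lt hε
    obtain ⟨n, hn⟩ := h k
    exact ⟨n, lt_trans hn hk⟩
  have : SecondCountableTopology E := UniformSpace.secondCountable_of_separable E
  rw [h]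
  refine .iInter fun k => .iUnion fun n => measurableSet_lt ?_ measurable_const
  exact measurable_snd.dist ((ξ n).stronglyMeasurable.measurable.comp measurable_fst)

theorem exists_represents [IsFiniteMeasure μ] [TopologicalSpace.SeparableSpace E]
    [MeasurableSpace E] [BorelSpace E] {A : Set (Ω →ₘ[μ] E)} (hp : p = 0 ∨ 1 ≤ p) (hp' : p ≠ ∞)
    (hA : A.Nonempty) (hAp : A ⊆ (Lp E p μ : Set (Ω →ₘ[μ] E))) :
    ∃ ξ : ℕ → Ω →ₘ[μ] E, (∀ n, ξ n ∈ clLp p μ (decHull p μ A)) ∧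
      Represents p μ (generatedSet ξ) A := by
  have hne : (clLp p μ (decHull p μ A)).Nonempty :=
    hA.mono ((subset_decHull A).trans (subset_clLp (decHull_subset_Lp hAp)))
  obtain ⟨ξ, hξ, h⟩ := exists_eq_selections hp' hne clLp_subset_Lp (clLp_clLp_subset hp)
    (isDecomposable_clLp hp isDecomposable_decHull)
  exact ⟨ξ, hξ, isClosedRandomSet_generatedSet ξ, h⟩

end Castaing

/-! ### Almost sure uniqueness of the random set -/

section Representation

variable {Ω E : Type*} [MeasurableSpace Ω] [NormedAddCommGroup E]
  [CompleteSpace E] [TopologicalSpace.SeparableSpace E] [MeasurableSpace E] [BorelSpace E]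
  {p : ℝ≥0∞} {μ : Measure Ω} {A : Set (Ω →ₘ[μ] E)}

/-- A closed random set with an integrable selection is determined, from above, by its integrable
selections. -/
theorem ae_subset_of_selections_subset [IsFiniteMeasure μ] {F G : Ω → Set E}
    (hF : IsClosedRandomSet μ F) (hG : IsClosedRandomSet μ G) (hne : (selections p μ F).Nonempty)
    (hFG : selections p μ F ⊆ selections p μ G) : ∀ᵐ ω ∂μ, F ω ⊆ G ω := by
  by_contra hcon
  have : SecondCountableTopology E := UniformSpace.secondCountable_of_separable E
  obtain ⟨B, hB, hBpos, η, hη, hηB⟩ := exists_measurable_section μ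
    (D := {z : Ω × E | z.2 ∈ F z.1} \ {z : Ω × E | z.2 ∈ G z.1}) (hF.1.diff hG.1) (fun h => hcon <| by
      filter_upwards [h] with ω hω x hx
      by_contra hxG
      exact hω x ⟨hx, hxG⟩)
  obtain ⟨ξ, hξp, hξF⟩ := hne
  -- The section `η` need not be integrable. On `C k` it is bounded, and gluing with `ξ` off `C k`
  -- yields an integrable selection of `F` that avoids `G` on `C k`.
  let C : ℕ → Set Ω := fun k => B ∩ {ω | ‖η ω‖ ≤ k}
  have hC : ∀ k, MeasurableSet (C k) := fun k =>
    hB.inter (measurableSet_le hη.norm measurable_const)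
  have hnull : ∀ k, μ (C k) = 0 := by
    intro k
    let θ : Ω →ₘ[μ] E := AEEqFun.mk ((C k).indicator η)
      (hη.indicator (hC k)).aestronglyMeasurable
    have hθ : ∀ᵐ ω ∂μ, θ ω = (C k).indicator η ω := AEEqFun.coeFn_mk _ _
    have hθp : θ ∈ Lp E p μ := by
      rw [Lp.mem_Lp_iff_memLp]
      refine MemLp.of_bound θ.aestronglyMeasurable k ?_
      filter_upwards [hθ] with ω hω
      rw [hω]
      by_cases h : ω ∈ C k
      · rw [Set.indicator_of_mem h]
        exact h.2
      · simp [h]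
    have hmem : glue (hC k) θ ξ ∈ selections p μ F := by
      refine ⟨glue_mem_Lp _ hθp hξp, ?_⟩
      filter_upwards [ae_glue (hC k) θ ξ, hθ, hξF] with ω h1 h2 h3
      by_cases h : ω ∈ C k
      · rw [h1.1 h, h2, Set.indicator_of_mem h]
        exact (hηB ω h.1).1
      · rwa [h1.2 h]
    have hG' : ∀ᵐ ω ∂μ, ω ∉ C k := by
      filter_upwards [ae_glue (hC k) θ ξ, hθ, (hFG hmem).2] with ω h1 h2 h3 h
      rw [h1.1 h, h2, Set.indicator_of_mem h] at h3
      exact (hηB ω h.1).2 h3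
    simpa [ae_iff] using hG'
  have hBC : B ⊆ ⋃ k, C k := fun ω hω =>
    Set.mem_iUnion.2 ((exists_nat_ge ‖η ω‖).imp fun k hk => ⟨hω, hk⟩)
  exact hBpos.ne' (measure_mono_null hBC (measure_iUnion_null hnull))

theorem ae_eq_of_selections_eq [IsFiniteMeasure μ] {F G : Ω → Set E}
    (hF : IsClosedRandomSet μ F) (hG : IsClosedRandomSet μ G) (hne : (selections p μ F).Nonempty)
    (hFG : selections p μ F = selections p μ G) : ∀ᵐ ω ∂μ, F ω = G ω := by
  filter_upwards [ae_subset_of_selections_subset hF hG hne hFG.subset,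
    ae_subset_of_selections_subset hG hF (hFG ▸ hne) hFG.symm.subset] with ω h1 h2
  exact h1.antisymm h2

theorem represents_ae_unique [IsFiniteMeasure μ] (hA : A.Nonempty)
    (hAp : A ⊆ (Lp E p μ : Set (Ω →ₘ[μ] E))) {F G : Ω → Set E} (hF : Represents p μ F A)
    (hG : Represents p μ G A) : ∀ᵐ ω ∂μ, F ω = G ω := by
  refine ae_eq_of_selections_eq hF.1 hG.1 ?_ (hF.2.symm.trans hG.2)
  rw [← hF.2]
  exact hA.mono ((subset_decHull A).trans (subset_clLp (decHull_subset_Lp hAp)))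

end Representation

/-! ### Barycenters and Choquet sets -/

section Barycenter

variable {V : Type*} [MeasurableSpace V]

/-- A two-point mixture. -/
noncomputable def twoPoint (a b : ℝ) (x y : V) : Measure V :=
  ENNReal.ofReal a • Measure.dirac x + ENNReal.ofReal b • Measure.dirac y

theorem isProbabilityMeasure_twoPoint {a b : ℝ} (ha : 0 ≤ a) (hb : 0 ≤ b) (hab : a + b = 1)
    (x y : V) : IsProbabilityMeasure (twoPoint a b x y) :=
  ⟨by simp [twoPoint, ← ENNReal.ofReal_add ha hb, hab]⟩

theorem twoPoint_apply_of_mem {a b : ℝ} (ha : 0 ≤ a) (hb : 0 ≤ b) (hab : a + b = 1)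
    {x y : V} {s : Set V} (hx : x ∈ s) (hy : y ∈ s) : twoPoint a b x y s = 1 := by
  simp [twoPoint, Measure.dirac_apply_of_mem hx, Measure.dirac_apply_of_mem hy,
    ← ENNReal.ofReal_add ha hb, hab]

theorem regular_of_finite_carrier [MetricSpace V] [BorelSpace V] {m : Measure V}
    [IsFiniteMeasure m] {s : Set V} (hs : s.Finite) (hm : m sᶜ = 0) : m.Regular where
  innerRegular := by
    intro U _ r hr
    refine ⟨U ∩ s, Set.inter_subset_left, (hs.inter_of_right U).isCompact, ?_⟩
    rwa [measure_inter_conull hm]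

theorem regular_twoPoint [MetricSpace V] [BorelSpace V] {a b : ℝ} (ha : 0 ≤ a) (hb : 0 ≤ b) (hab : a + b = 1)
    (x y : V) :
    (twoPoint a b x y).Regular := by
  have := isProbabilityMeasure_twoPoint ha hb hab x y
  refine regular_of_finite_carrier (s := {x, y}) (by simp) ?_
  rw [prob_compl_eq_zero_iff (Set.Finite.measurableSet (by simp))]
  exact twoPoint_apply_of_mem ha hb hab (by simp) (by simp)

variable [NormedAddCommGroup V] [NormedSpace ℝ V]

/-- The barycenter of a probability measure carried by a closed convex set lies in this set. -/
theorem mem_of_isBarycenter {m : Measure V} [IsProbabilityMeasure m] {C : Set V}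
    (hC : IsClosed C) (hconv : Convex ℝ C) (hm : ∀ᵐ x ∂m, x ∈ C) {y : V}
    (hy : IsBarycenter m y) : y ∈ C := by
  by_contra hyC
  obtain ⟨L, u, hLu, huL⟩ := geometric_hahn_banach_closed_point hconv hC hyC
  have h : ∫ x, L x ∂m ≤ ∫ _, u ∂m := by
    refine integral_mono_ae (hy L).1 (integrable_const u) ?_
    filter_upwards [hm] with x hx
    exact (hLu x hx).le
  rw [← (hy L).2, integral_const, probReal_univ, one_smul] at h
  exact absurd huL h.not_gt

variable [BorelSpace V]

theorem isBarycenter_dirac (x : V) : IsBarycenter (Measure.dirac x) x :=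
  fun L => ⟨integrable_dirac (by simp), by simp⟩

theorem isBarycenter_twoPoint {a b : ℝ} (ha : 0 ≤ a) (hb : 0 ≤ b) (x y : V) :
    IsBarycenter (twoPoint a b x y) (a • x + b • y) := by
  intro L
  have hx : Integrable (fun z => L z) (ENNReal.ofReal a • Measure.dirac x) :=
    (isBarycenter_dirac x L).1.smul_measure ENNReal.ofReal_ne_top
  have hy : Integrable (fun z => L z) (ENNReal.ofReal b • Measure.dirac y) :=
    (isBarycenter_dirac y L).1.smul_measure ENNReal.ofReal_ne_top
  refine ⟨hx.add_measure hy, ?_⟩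
  rw [twoPoint, integral_add_measure hx hy, integral_smul_measure, integral_smul_measure]
  simp [ENNReal.toReal_ofReal ha, ENNReal.toReal_ofReal hb]

theorem eq_of_isBarycenter_dirac {x y : V} (h : IsBarycenter (Measure.dirac x) y) : y = x := by
  refine (SeparatingDual.eq_iff_forall_dual_eq (R := ℝ)).2 fun L => ?_
  rw [(h L).2, ← (isBarycenter_dirac x L).2]

theorem subset_choquetHull (A : Set V) : A ⊆ choquetHull A := fun _ hx _ hB => hB.1 hx

theorem isChoquetSet_choquetHull (A : Set V) : IsChoquetSet (choquetHull A) := by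
  rintro y ⟨m, hm, hreg, ⟨B, hBA, hB, hmB⟩, hy⟩ C hC
  exact hC.2 y ⟨m, hm, hreg, ⟨B, fun x hx => hBA hx C hC, hB, hmB⟩, hy⟩

theorem IsChoquetSet.convex {A : Set V} (hA : IsChoquetSet A) : Convex ℝ A := by
  intro x hx y hy a b ha hb hab
  refine hA _ ⟨twoPoint a b x y, isProbabilityMeasure_twoPoint ha hb hab x y,
    regular_twoPoint ha hb hab x y, ⟨{x, y}, ?_, Set.Finite.measurableSet (by simp),
      twoPoint_apply_of_mem ha hb hab (by simp) (by simp)⟩, isBarycenter_twoPoint ha hb x y⟩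
  rintro z (rfl | rfl)
  exacts [hx, hy]

theorem isChoquetSet_of_isClosed {A : Set V} (hA : IsClosed A) (hconv : Convex ℝ A) :
    IsChoquetSet A := by
  rintro y ⟨m, hm, -, ⟨B, hBA, hB, hmB⟩, hy⟩
  refine mem_of_isBarycenter hA hconv ?_ hy
  filter_upwards [(mem_ae_iff_prob_eq_one hB).2 hmB] with x hx
  exact hBA hx

end Barycenter

/-! ### Choquet decomposability versus closed decomposability -/

section Decomposable

variable {Ω E : Type*} [MeasurableSpace Ω] [NormedAddCommGroup E]
  {p : ℝ≥0∞} {μ : Measure Ω} {A S T : Set (Ω →ₘ[μ] E)}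

/-- Closed decomposable subsets of `L^p(E)`. -/
structure IsClosedDecomposable (p : ℝ≥0∞) (μ : Measure Ω) (S : Set (Ω →ₘ[μ] E)) : Prop where
  subset_Lp : S ⊆ (Lp E p μ : Set (Ω →ₘ[μ] E))
  clLp_subset : clLp p μ S ⊆ S
  isDecomposable : IsDecomposable μ S

theorem isClosedDecomposable_clLp [IsFiniteMeasure μ] (hp : p = 0 ∨ 1 ≤ p)
    (hS : IsDecomposable μ S) : IsClosedDecomposable p μ (clLp p μ S) :=
  ⟨clLp_subset_Lp, clLp_clLp_subset hp, isDecomposable_clLp hp hS⟩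

theorem IsClosedDecomposable.clLp_decHull_subset (hT : IsClosedDecomposable p μ T) (h : S ⊆ T) :
    clLp p μ (decHull p μ S) ⊆ T :=
  (clLp_mono (decHull_subset_of_isDecomposable h hT.1 hT.3)).trans hT.2

theorem subset_clLp_decHull [IsFiniteMeasure μ] (hS : S ⊆ (Lp E p μ : Set (Ω →ₘ[μ] E))) :
    S ⊆ clLp p μ (decHull p μ S) :=
  (subset_decHull S).trans (subset_clLp (decHull_subset_Lp hS))

theorem IsClosedDecomposable.clLp_decHull_eq [IsFiniteMeasure μ]
    (hS : IsClosedDecomposable p μ S) : clLp p μ (decHull p μ S) = S :=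
  (hS.clLp_decHull_subset subset_rfl).antisymm (subset_clLp_decHull hS.1)

theorem regular_of_separable [CompleteSpace E]
    [TopologicalSpace.SeparableSpace E] [MeasurableSpace E] [BorelSpace E] (m : Measure E) [IsFiniteMeasure m] : m.Regular := by
  have : SecondCountableTopology E := UniformSpace.secondCountable_of_separable E
  infer_instance

/-- Limits are handled along an almost surely convergent subsequence. Only closed values matter, so
this applies to pointwise closed convex hulls without discussing their measurability. -/
theorem isClosedDecomposable_selections [IsFiniteMeasure μ] {F : Ω → Set E}
    (hF : ∀ᵐ ω ∂μ, IsClosed (F ω)) : IsClosedDecomposable p μ (selections p μ F) := by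
  refine ⟨fun f hf => hf.1, ?_, isDecomposable_iff.2 fun f hf g hg B hB =>
    ⟨glue_mem_Lp hB hf.1 hg.1, ?_⟩⟩
  · rintro f ⟨hf, u, hu, hlim⟩
    refine ⟨hf, ?_⟩
    obtain ⟨φ, -, hφ⟩ := (tendstoInMeasure_of_convergesLp hlim).exists_seq_tendsto_ae
    filter_upwards [hφ, ae_all_iff.2 fun n => (hu n).2, hF] with ω h1 h2 h3
    exact h3.mem_of_tendsto h1 (.of_forall fun n => h2 _)
  · filter_upwards [hf.2, hg.2, ae_glue hB f g] with ω h1 h2 h3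
    by_cases h : ω ∈ B
    · rwa [h3.1 h]
    · rwa [h3.2 h]

theorem convex_selections [NormedSpace ℝ E] {F : Ω → Set E} (hF : ∀ᵐ ω ∂μ, Convex ℝ (F ω)) :
    Convex ℝ (selections p μ F) := by
  intro f hf g hg a b ha hb hab
  refine ⟨convex_Lp hf.1 hg.1 ha hb hab, ?_⟩
  filter_upwards [hf.2, hg.2, coeFn_comb a b f g, hF] with ω h1 h2 h3 h4
  rw [h3]
  exact h4 h1 h2 ha hb hab

theorem IsChoquetConvexDecomposable.isChoquetDecomposable [NormedSpace ℝ E]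
    [MeasurableSpace E]
    (hS : IsChoquetConvexDecomposable p μ S) : IsChoquetDecomposable p μ S :=
  ⟨hS.1, fun K hK _ => hS.2 K hK⟩

/-- The random set generated by a sequence of members of a convex set of selections is convex. -/
theorem ae_convex_generatedSet [NormedSpace ℝ E] {ξ : ℕ → Ω →ₘ[μ] E} (hconv : Convex ℝ S) (hξ : ∀ n, ξ n ∈ S)
    (hS : S ⊆ selections p μ (generatedSet ξ)) :
    ∀ᵐ ω ∂μ, Convex ℝ (generatedSet ξ ω) := by
  -- Rational weights and pairs from the sequence leave countably many null sets; closedness then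
  -- extends this to all points and all real weights.
  have key : ∀ᵐ ω ∂μ, ∀ (q : ℚ) (n m : ℕ), (q : ℝ) ∈ Set.Ioo (0 : ℝ) 1 →
      (q : ℝ) • ξ n ω + (1 - (q : ℝ)) • ξ m ω ∈ generatedSet ξ ω := by
    simp only [ae_all_iff]
    intro q n m hq
    filter_upwards [(hS (hconv (hξ n) (hξ m) hq.1.le (sub_nonneg.2 hq.2.le) (by ring))).2,
      coeFn_comb (q : ℝ) (1 - q) (ξ n) (ξ m)] with ω h1 h2
    rwa [← h2]
  filter_upwards [key] with ω hω
  have hclosed : IsClosed (generatedSet ξ ω) := isClosed_closure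
  rw [convex_iff_forall_pos]
  intro x hx y hy a b ha hb hab
  obtain rfl : b = 1 - a := by linarith
  have hrat : ∀ q : ℚ, (q : ℝ) ∈ Set.Ioo (0 : ℝ) 1 →
      (q : ℝ) • x + (1 - (q : ℝ)) • y ∈ generatedSet ξ ω := by
    intro q hq
    have hc : Continuous (Function.uncurry fun x y : E => (q : ℝ) • x + (1 - (q : ℝ)) • y) := by
      fun_prop
    have := map_mem_closure₂ hc hx hy (u := generatedSet ξ ω) (by
      rintro _ ⟨n, rfl⟩ _ ⟨m, rfl⟩
      exact hω q n m hq)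
    rwa [hclosed.closure_eq] at this
  have hc : IsClosed {t : ℝ | t • x + (1 - t) • y ∈ generatedSet ξ ω} :=
    hclosed.preimage (by fun_prop : Continuous fun t : ℝ => t • x + (1 - t) • y)
  have hsub := (Rat.denseRange_cast (𝕜 := ℝ)).open_subset_closure_inter
    (isOpen_Ioo (a := (0 : ℝ)) (b := 1))
  refine closure_minimal ?_ hc (hsub ⟨ha, by linarith⟩)
  rintro _ ⟨hq, q, rfl⟩
  exact hrat q hq

/-- The kernel `a δ_f + b δ_g` has barycenter `a f + b g`. -/
theorem IsChoquetConvexDecomposable.convex [NormedSpace ℝ E]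
    [TopologicalSpace.SeparableSpace E] [MeasurableSpace E] [BorelSpace E] [IsFiniteMeasure μ]
    (hp : p = 0 ∨ 1 ≤ p)
    (hp' : p ≠ ∞) (hS : IsChoquetConvexDecomposable p μ S) : Convex ℝ S := by
  intro f hf g hg a b ha hb hab
  have : SecondCountableTopology E := UniformSpace.secondCountable_of_separable E
  obtain ⟨ξ, -, hF⟩ := exists_represents hp hp' ⟨f, hf⟩ hS.1
  have hsel : S ⊆ selections p μ (generatedSet ξ) := hF.2 ▸ subset_clLp_decHull hS.1
  let K : Kernel Ω E := ⟨fun ω => twoPoint a b (f ω) (g ω), by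
    refine Measure.measurable_of_measurable_coe _ fun s hs => ?_
    simp only [twoPoint, Measure.add_apply, Measure.smul_apply, smul_eq_mul]
    exact (((Measure.measurable_coe hs).comp
      (Measure.measurable_dirac.comp f.stronglyMeasurable.measurable)).const_mul _).add
      (((Measure.measurable_coe hs).comp
      (Measure.measurable_dirac.comp g.stronglyMeasurable.measurable)).const_mul _)⟩
  have hK : ∀ ω, K ω = twoPoint a b (f ω) (g ω) := fun ω => rfl
  refine hS.2 K ⟨⟨fun ω => isProbabilityMeasure_twoPoint ha hb hab _ _⟩,
    fun ω => regular_twoPoint ha hb hab _ _, _, hF, ?_⟩ _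
    (convex_Lp (hS.1 hf) (hS.1 hg) ha hb hab) ?_
  · filter_upwards [(hsel hf).2, (hsel hg).2] with ω h1 h2
    rw [hK, twoPoint_apply_of_mem ha hb hab h1 h2]
  · filter_upwards [coeFn_comb a b f g] with ω hω
    rw [hω, hK]
    exact isBarycenter_twoPoint ha hb _ _

variable [NormedSpace ℝ E] [CompleteSpace E] [TopologicalSpace.SeparableSpace E]
  [MeasurableSpace E] [BorelSpace E]

/-- Each `f` in `cl_p dec S` is the barycenter of the deterministic kernel `δ_f`, so `S = cl_p dec
S`. -/
theorem IsChoquetDecomposable.isClosedDecomposable [IsFiniteMeasure μ] (hp : p = 0 ∨ 1 ≤ p)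
    (hp' : p ≠ ∞) (hne : S.Nonempty) (hS : IsChoquetDecomposable p μ S) :
    IsClosedDecomposable p μ S := by
  have : SecondCountableTopology E := UniformSpace.secondCountable_of_separable E
  obtain ⟨ξ, -, hF⟩ := exists_represents hp hp' hne hS.1
  have hsub : clLp p μ (decHull p μ S) ⊆ S := by
    intro f hf
    refine hS.2 (Kernel.deterministic f f.stronglyMeasurable.measurable)
      ⟨inferInstance, fun ω => regular_of_separable _, _, hF, ?_⟩ (.of_forall fun ω => ?_) f hf.1
      (.of_forall fun ω => ?_)
    · have hf' := hf
      rw [hF.2] at hf'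
      filter_upwards [hf'.2] with ω hω
      rw [Kernel.deterministic_apply, Measure.dirac_apply_of_mem hω]
    · exact ⟨f ω, Kernel.deterministic_apply _ _⟩
    · rw [Kernel.deterministic_apply]
      exact isBarycenter_dirac _
  have heq := hsub.antisymm (subset_clLp_decHull hS.1)
  exact heq ▸ isClosedDecomposable_clLp hp isDecomposable_decHull

theorem IsClosedDecomposable.isChoquetDecomposable [IsFiniteMeasure μ]
    (hS : IsClosedDecomposable p μ S) : IsChoquetDecomposable p μ S := by
  refine ⟨hS.1, fun K hK hdirac Y hY hbar => ?_⟩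
  obtain ⟨-, -, F, hF, hKF⟩ := hK
  have heq : S = selections p μ F := hS.clLp_decHull_eq.symm.trans hF.2
  rw [heq]
  refine ⟨hY, ?_⟩
  filter_upwards [hdirac, hbar, hKF] with ω ⟨x, hx⟩ h2 h3
  rw [hx] at h2 h3
  rw [eq_of_isBarycenter_dirac h2]
  by_contra hxF
  rw [Measure.dirac_apply, Set.indicator_of_notMem hxF] at h3
  exact zero_ne_one h3

theorem chd_eq [IsFiniteMeasure μ] (hp : p = 0 ∨ 1 ≤ p) (hp' : p ≠ ∞) (hA : A.Nonempty)
    (hAp : A ⊆ (Lp E p μ : Set (Ω →ₘ[μ] E))) : chd p μ A = clLp p μ (decHull p μ A) := by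
  refine subset_antisymm (fun f hf => hf _ ⟨subset_clLp_decHull hAp,
    (isClosedDecomposable_clLp hp isDecomposable_decHull).isChoquetDecomposable⟩) ?_
  intro f hf B hB
  exact (hB.2.isClosedDecomposable hp hp' (hA.mono hB.1)).clLp_decHull_subset hB.1 hf

/-- The random set representing a convex closed decomposable set has convex values. -/
theorem ae_convex_of_represents [IsFiniteMeasure μ] (hp' : p ≠ ∞) (hne : S.Nonempty)
    (hS : IsClosedDecomposable p μ S) (hconv : Convex ℝ S) {F : Ω → Set E}
    (hF : Represents p μ F S) : ∀ᵐ ω ∂μ, Convex ℝ (F ω) := by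
  obtain ⟨ξ, hξ, h⟩ := exists_eq_selections hp' hne hS.1 hS.2 hS.3
  filter_upwards [ae_convex_generatedSet hconv hξ h.subset, represents_ae_unique hne hS.1 hF
    ⟨isClosedRandomSet_generatedSet ξ, hS.clLp_decHull_eq.trans h⟩] with ω h1 h2
  rwa [h2]

theorem IsClosedDecomposable.isChoquetConvexDecomposable [IsFiniteMeasure μ] (hp' : p ≠ ∞)
    (hne : S.Nonempty) (hS : IsClosedDecomposable p μ S) (hconv : Convex ℝ S) :
    IsChoquetConvexDecomposable p μ S := by
  refine ⟨hS.1, fun K hK Y hY hbar => ?_⟩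
  obtain ⟨hKm, -, F, hF, hKF⟩ := hK
  have heq : S = selections p μ F := hS.clLp_decHull_eq.symm.trans hF.2
  have hFconv := ae_convex_of_represents hp' hne hS hconv hF
  rw [heq]
  refine ⟨hY, ?_⟩
  filter_upwards [hbar, hKF, hFconv, hF.1.2] with ω h1 h2 h3 h4
  exact mem_of_isBarycenter h4 h3 ((mem_ae_iff_prob_eq_one h4.measurableSet).2 h2) h1

/-- The Choquet convex decomposable hull is the smallest convex closed decomposable superset. -/
theorem chcd_eq_of_minimal [IsFiniteMeasure μ] (hp : p = 0 ∨ 1 ≤ p) (hp' : p ≠ ∞)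
    (hA : A.Nonempty) (hAS : A ⊆ S) (hS : IsClosedDecomposable p μ S) (hconv : Convex ℝ S)
    (hmin : ∀ T, A ⊆ T → IsClosedDecomposable p μ T → Convex ℝ T → S ⊆ T) :
    chcd p μ A = S := by
  refine subset_antisymm (fun f hf =>
    hf S ⟨hAS, hS.isChoquetConvexDecomposable hp' (hA.mono hAS) hconv⟩) fun f hf B hB => ?_
  exact hmin B hB.1 (hB.2.isChoquetDecomposable.isClosedDecomposable hp hp' (hA.mono hB.1))
    (hB.2.convex hp hp') hf

/-- For minimality: a convex closed decomposable `T ⊇ A` is `L^p` of a random set with closed convex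
values that contains `F` almost surely, hence also its closed convex hull. -/
theorem chcd_eq_selections_closedConvexHull [IsFiniteMeasure μ] (hp : p = 0 ∨ 1 ≤ p)
    (hp' : p ≠ ∞) (hA : A.Nonempty) (hAp : A ⊆ (Lp E p μ : Set (Ω →ₘ[μ] E))) {F : Ω → Set E}
    (hF : Represents p μ F A) :
    chcd p μ A = selections p μ (fun ω => closedConvexHull ℝ (F ω)) := by
  have hAF : A ⊆ selections p μ F := hF.2 ▸ subset_clLp_decHull hAp
  refine chcd_eq_of_minimal hp hp' hA (fun f hf => ⟨hAp hf, ?_⟩)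
    (isClosedDecomposable_selections (.of_forall fun ω => isClosed_closedConvexHull))
    (convex_selections (.of_forall fun ω => convex_closedConvexHull)) ?_
  · filter_upwards [(hAF hf).2] with ω hω
    exact subset_closedConvexHull hω
  · intro T hAT hT hconv f hf
    obtain ⟨ξ, hξ, hTξ⟩ := exists_eq_selections hp' (hA.mono hAT) hT.1 hT.2 hT.3
    have hFT : selections p μ F ⊆ selections p μ (generatedSet ξ) := by
      rw [← hF.2, ← hTξ]
      exact hT.clLp_decHull_subset hAT
    rw [hTξ]
    refine ⟨hf.1, ?_⟩
    filter_upwards [hf.2, ae_subset_of_selections_subset hF.1 (isClosedRandomSet_generatedSet ξ)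
      (hA.mono hAF) hFT, ae_convex_generatedSet hconv hξ hTξ.subset] with ω h1 h2 h3
    exact closedConvexHull_min h2 h3 isClosed_closure h1

/-- The intermediate `S` covers both `dec A` and `cl_p dec A`. -/
theorem chcd_eq_cconvLp [IsFiniteMeasure μ] (hp : p = 0 ∨ 1 ≤ p) (hp' : p ≠ ∞) (hA : A.Nonempty)
    (hAS : A ⊆ S) (hS : IsDecomposable μ S) (hSp : S ⊆ clLp p μ (decHull p μ A)) :
    chcd p μ A = cconvLp p μ S := by
  have hSLp : convexHull ℝ S ⊆ (Lp E p μ : Set (Ω →ₘ[μ] E)) :=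
    convexHull_min (hSp.trans clLp_subset_Lp) convex_Lp
  refine chcd_eq_of_minimal hp hp' hA
    (hAS.trans ((subset_convexHull ℝ S).trans (subset_clLp hSLp)))
    (isClosedDecomposable_clLp hp (isDecomposable_convexHull hS))
    (convex_clLp hp (convex_convexHull ℝ S)) fun T hAT hT hconv => ?_
  exact (clLp_mono (convexHull_min (hSp.trans (hT.clLp_decHull_subset hAT)) hconv)).trans hT.2

/-- The intermediate `S` covers both `conv A` and `ch A`. -/
theorem chcd_eq_clLp_decHull [IsFiniteMeasure μ] (hp : p = 0 ∨ 1 ≤ p) (hp' : p ≠ ∞)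
    (hA : A.Nonempty) (hAS : A ⊆ S) (hS : Convex ℝ S) (hSp : S ⊆ clLp p μ (convexHull ℝ A)) :
    chcd p μ A = clLp p μ (decHull p μ S) := by
  have hSLp := hSp.trans clLp_subset_Lp
  refine chcd_eq_of_minimal hp hp' hA (hAS.trans (subset_clLp_decHull hSLp))
    (isClosedDecomposable_clLp hp isDecomposable_decHull)
    (convex_clLp hp (convex_decHull hSLp hS)) fun T hAT hT hconv => ?_
  exact hT.clLp_decHull_subset (hSp.trans ((clLp_mono (convexHull_min hAT hconv)).trans hT.2))

end Decomposable

/-! ### The Choquet hull in the Banach space `L^p(E)` -/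

section ChoquetHullLp

variable {Ω E : Type*} [MeasurableSpace Ω] [NormedAddCommGroup E]
  {p : ℝ≥0∞} {μ : Measure Ω} {A S : Set (Ω →ₘ[μ] E)}

theorem convex_preimage_Lp [NormedSpace ℝ E] (hS : Convex ℝ S) :
    Convex ℝ {f : Lp E p μ | (f : Ω →ₘ[μ] E) ∈ S} :=
  fun _ hf _ hg _ _ ha hb hab => hS hf hg ha hb hab

theorem isClosed_preimage_Lp [Fact (1 ≤ p)] (hS : clLp p μ S ⊆ S) :
    IsClosed {f : Lp E p μ | (f : Ω →ₘ[μ] E) ∈ S} := by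
  rw [← isSeqClosed_iff_isClosed]
  intro u f hu hlim
  refine hS ⟨f.2, fun n => u n, hu, ?_⟩
  have hp : p ≠ 0 := (zero_lt_one.trans_le Fact.out).ne'
  rw [ConvergesLp, if_neg hp]
  exact (Lp.tendsto_Lp_iff_tendsto_eLpNorm' u f).1 hlim

variable [NormedSpace ℝ E] [Fact (1 ≤ p)]

theorem subset_choquetHullLp (hA : A ⊆ (Lp E p μ : Set (Ω →ₘ[μ] E))) :
    A ⊆ choquetHullLp p μ A := by
  let _ : MeasurableSpace (Lp E p μ) := borel (Lp E p μ)
  have : BorelSpace (Lp E p μ) := ⟨rfl⟩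
  exact fun f hf => ⟨⟨f, hA hf⟩, subset_choquetHull _ hf, rfl⟩

theorem convex_choquetHullLp : Convex ℝ (choquetHullLp p μ A) := by
  let _ : MeasurableSpace (Lp E p μ) := borel (Lp E p μ)
  have : BorelSpace (Lp E p μ) := ⟨rfl⟩
  rintro _ ⟨f, hf, rfl⟩ _ ⟨g, hg, rfl⟩ a b ha hb hab
  exact ⟨a • f + b • g, (isChoquetSet_choquetHull _).convex hf hg ha hb hab, rfl⟩

/-- Closed convex sets are Choquet sets, by Hahn–Banach in `L^p(E)`. -/
theorem choquetHullLp_subset (hAS : A ⊆ S) (hcl : clLp p μ S ⊆ S) (hS : Convex ℝ S) :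
    choquetHullLp p μ A ⊆ S := by
  let _ : MeasurableSpace (Lp E p μ) := borel (Lp E p μ)
  have : BorelSpace (Lp E p μ) := ⟨rfl⟩
  rintro _ ⟨f, hf, rfl⟩
  exact hf {f : Lp E p μ | (f : Ω →ₘ[μ] E) ∈ S} ⟨fun g hg => hAS hg,
    isChoquetSet_of_isClosed (isClosed_preimage_Lp hcl) (convex_preimage_Lp hS)⟩

end ChoquetHullLp

end ChoquetHulls

/-! ### The coincidence of the hulls -/

theorem corollary7p5 {Ω E : Type*} [MeasurableSpace Ω] (μ : Measure Ω) [IsProbabilityMeasure μ]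
    [μ.IsComplete] [NormedAddCommGroup E] [NormedSpace ℝ E] [CompleteSpace E]
    [TopologicalSpace.SeparableSpace E] [MeasurableSpace E] [BorelSpace E]
    (p : ℝ≥0∞) (hp : p = 0 ∨ (1 ≤ p ∧ p ≠ ∞))
    (A : Set (Ω →ₘ[μ] E)) (hA : A.Nonempty) (hAp : A ⊆ (Lp E p μ : Set (Ω →ₘ[μ] E))) :
    -- the random set `F_A` exists and is almost surely unique
    (∃ F : Ω → Set E, Represents p μ F A) ∧
    (∀ F G : Ω → Set E, Represents p μ F A → Represents p μ G A → ∀ᵐ ω ∂μ, F ω = G ω) ∧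
    -- the hulls coincide
    (∀ [Fact (1 ≤ p)], chcd p μ A = chd p μ (choquetHullLp p μ A)) ∧
    chcd p μ A = chd p μ (convexHull ℝ A) ∧
    (∀ F : Ω → Set E, Represents p μ F A →
      chcd p μ A = selections p μ (fun ω => closedConvexHull ℝ (F ω)) ∧
      chcd p μ A = cconvLp p μ (selections p μ F)) ∧
    chcd p μ A = cconvLp p μ (chd p μ A) ∧
    chcd p μ A = clLp p μ (convexHull ℝ (decHull p μ A)) ∧
    chcd p μ A = clLp p μ (decHull p μ (convexHull ℝ A)) := by
  have hp1 : p = 0 ∨ 1 ≤ p := hp.imp_right And.left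
  have hp' : p ≠ ∞ := by
    rcases hp with rfl | h
    exacts [ENNReal.zero_ne_top, h.2]
  have hconvp : convexHull ℝ A ⊆ (Lp E p μ : Set (Ω →ₘ[μ] E)) := convexHull_min hAp convex_Lp
  have hconv_dec : chcd p μ A = cconvLp p μ (clLp p μ (decHull p μ A)) :=
    chcd_eq_cconvLp hp1 hp' hA (subset_clLp_decHull hAp)
      (isDecomposable_clLp hp1 isDecomposable_decHull) subset_rfl
  have hdec_conv : chcd p μ A = clLp p μ (decHull p μ (convexHull ℝ A)) :=
    chcd_eq_clLp_decHull hp1 hp' hA (subset_convexHull ℝ A) (convex_convexHull ℝ A)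
      (subset_clLp hconvp)
  refine ⟨?_, fun F G => represents_ae_unique hA hAp, ?_, ?_, fun F hF => ⟨?_, ?_⟩, ?_, ?_,
    hdec_conv⟩
  · obtain ⟨ξ, -, hξ⟩ := exists_represents hp1 hp' hA hAp
    exact ⟨_, hξ⟩
  · intro _
    have hsub := subset_choquetHullLp hAp
    have hcl : choquetHullLp p μ A ⊆ clLp p μ (convexHull ℝ A) :=
      choquetHullLp_subset ((subset_convexHull ℝ A).trans (subset_clLp hconvp))
        (clLp_clLp_subset hp1) (convex_clLp hp1 (convex_convexHull ℝ A))
    rw [chd_eq hp1 hp' (hA.mono hsub) (hcl.trans clLp_subset_Lp)]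
    exact chcd_eq_clLp_decHull hp1 hp' hA hsub convex_choquetHullLp hcl
  · rw [chd_eq hp1 hp' (hA.mono (subset_convexHull ℝ A)) hconvp]
    exact hdec_conv
  · exact chcd_eq_selections_closedConvexHull hp1 hp' hA hAp hF
  · rw [← hF.2]
    exact hconv_dec
  · rw [chd_eq hp1 hp' hA hAp]
    exact hconv_dec
  · exact chcd_eq_cconvLp hp1 hp' hA (subset_decHull A) isDecomposable_decHull
      (subset_clLp (decHull_subset_Lp hAp))
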